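/- Let $C$ be an algebraically closed field of characteristic zero and $D=d/dx$, so that $C(x)[D]$ is the ring of linear differential operators with $Da=aD+a'$ for $a\in C(x)$. A point $\xi\in C$ is an ordinary point of $L=\ell_0+\cdots+\ell_rD^r$ ($\ell_r\ne0$, $r=\operatorname{ord}L$) if no $\ell_i/\ell_r$ has a pole at $\xi$. An operator is primitive if its coefficients are coprime polynomials in $C[x]$ and its leading coefficient is monic. $P$ is a right factor of $M$ if $M=AP$ for some $A\in C(x)[D]$. The symmetric product $L_1\otimes L_2$ of nonzero operators is the primitive operator of lowest order that annihilates $f_1f_2$ for all solutions $f_1$ of $L_1$ and $f_2$ of $L_2$ in any differential ring over $C(x)$; $L^{\otimes s}$ is the $s$-fold symmetric product, with $L^{\otimes 0}=D$. The quasi-symmetric quotient of $M$ by $L$ is the unique primitive operator $Q$ of maximal order such that $L\otimes Q$ is a right factor of $M$. $V(L)$ is the solution space of $L$ in $C((x))$, and $(V(M):V(L))=\{h\in C((x)) : hV(L)\subseteq V(M)\}$. $L$ has only algebraic solutions if, for some finite extension field $E$ of $C(x)$ with the extended derivation, the $C$-space of solutions of $L$ in $E$ has dimension $\operatorname{ord}(L)$.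 For $N\in C[x][D]$, write $N\cdot x^s=x^{s+\sigma}(p_0(s)+p_1(s)x+\cdots+p_t(s)x^t)$ with $p_i\in C[s]$, $p_0\neq0$, and let $Z_N=\{k\in\mathbb N : p_0(k)=0\}$. Local algorithm (for $M,L$ with ordinary point $0$). Let $r=\operatorname{ord}L$ and $\delta=\dim_C(V(M):V(L))$. If $\delta=0$, return $1$. Otherwise let $k=\max Z_N-\frac{r(r-1)}2+1$ with $N=M\otimes L^{\otimes(r-1)}$, let $d_0$ be an upper bound for the degrees of the coefficients of the quasi-symmetric quotient of $M$ by $L$ in case it has order $\delta$, and repeat the following. (1) Compute the truncations $h_1,\dots,h_\delta$ at precision $k$ (terms of degree at most $k$) of a basis of $(V(M):V(L))$. (2) Let $d=\min\{d_0,\lfloor (k-\delta)/(\delta+1)\rfloor\}$ and let $Q$ be some primitive operator $q_0+\cdots+q_\delta D^\delta$ with $\deg q_i\le d$ and $Q\cdot h_j=O(x^{k-\delta})$ for all $j$, or $Q=\emptyset$ if there is none. (3) If $Q=\emptyset$ and $k\ge(\delta+1)(d_0+1)+\delta$, return None. (4) If $Q\ne\emptyset$, $\operatorname{ord}Q=\delta$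 and $L\otimes Q$ is a right factor of $M$, return $Q$. (5) Replace $k$ by $2k$. Global algorithm. Choose an arbitrary ordinary point $\xi\in C$ of $L$ and $M$, and apply the local algorithm to the operators $M_\xi$, $L_\xi$ obtained by $x\mapsto x+\xi$. If it returns None, return Fail; if it returns $Q_\xi$, return the operator obtained from $Q_\xi$ by $x\mapsto x-\xi$. Theorem. Let $L,M\in C(x)[D]$ be of positive order. If $L$ and $M$ have only algebraic solutions, then the quasi-symmetric quotient of $M$ by $L$ exists and is unique, and the global algorithm terminates and returns it, whatever ordinary point $\xi$, degree bound $d_0$, bases and candidates $Q$ are chosen on the way (and admissible choices always exist). -/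

import Mathlib

open Polynomial
open scoped Differential

noncomputable section

namespace SymDiv

universe u

variable {C : Type u} [Field C]

/-! ### The differential fields `C(x)` and `C((x))` -/

/-- A commutative ring with an additive map satisfying the Leibniz rule. -/
@[reducible]
def mkDifferential {R : Type*} [CommRing R] (d : R → R) (hadd : ∀ a b, d (a + b) = d a + d b)
    (hmul : ∀ a b, d (a * b) = a * d b + b * d a) : Differential R where
  deriv := Derivation.mk' (AddMonoidHom.mk' d hadd).toIntLinearMap (fun a b => hmul a b)

/-- The derivative `d/dx` of a rational function, by the quotient rule. -/
def ratDeriv (f : RatFunc C) : RatFunc C :=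
  (algebraMap C[X] (RatFunc C) (derivative f.num * f.denom - f.num * derivative f.denom)) /
    (algebraMap C[X] (RatFunc C) f.denom) ^ 2

theorem ratDeriv_div (p q : C[X]) (hq : q ≠ 0) :
    ratDeriv (algebraMap C[X] (RatFunc C) p / algebraMap C[X] (RatFunc C) q) =
      algebraMap C[X] (RatFunc C) (derivative p * q - p * derivative q) /
        (algebraMap C[X] (RatFunc C) q) ^ 2 := by
  set f : RatFunc C := algebraMap C[X] (RatFunc C) p / algebraMap C[X] (RatFunc C) q with hf
  have hd : f.denom ≠ 0 := f.denom_ne_zero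
  have hinj := RatFunc.algebraMap_injective C
  have hd' : algebraMap C[X] (RatFunc C) f.denom ≠ 0 := RatFunc.algebraMap_ne_zero hd
  have hq' : algebraMap C[X] (RatFunc C) q ≠ 0 := RatFunc.algebraMap_ne_zero hq
  have hc : f.num * q = p * f.denom := by
    apply hinj
    rw [map_mul, map_mul]
    have h1 := RatFunc.num_div_denom f
    rw [hf, div_eq_div_iff (by rwa [← hf]) hq'] at h1
    rw [hf]; exact h1
  have hc' : derivative f.num * q + f.num * derivative q
      = derivative p * f.denom + p * derivative f.denom := by
    rw [← derivative_mul, ← derivative_mul, hc]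
  unfold ratDeriv
  rw [div_eq_div_iff (pow_ne_zero 2 hd') (pow_ne_zero 2 hq'), ← map_pow, ← map_pow, ← map_mul,
    ← map_mul]
  congr 1
  linear_combination (q * f.denom) * hc' - (f.denom * derivative q + q * derivative f.denom) * hc

theorem ratDeriv_add (f g : RatFunc C) : ratDeriv (f + g) = ratDeriv f + ratDeriv g := by
  have hf : algebraMap C[X] (RatFunc C) f.denom ≠ 0 :=
    RatFunc.algebraMap_ne_zero f.denom_ne_zero
  have hg : algebraMap C[X] (RatFunc C) g.denom ≠ 0 :=
    RatFunc.algebraMap_ne_zero g.denom_ne_zero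
  have h : f + g = algebraMap C[X] (RatFunc C) (f.num * g.denom + f.denom * g.num) /
      algebraMap C[X] (RatFunc C) (f.denom * g.denom) := by
    conv_lhs => rw [← RatFunc.num_div_denom f, ← RatFunc.num_div_denom g]
    rw [div_add_div _ _ hf hg]
    simp only [map_add, map_mul]
  rw [h, ratDeriv_div _ _ (mul_ne_zero f.denom_ne_zero g.denom_ne_zero)]
  unfold ratDeriv
  simp only [derivative_mul, map_add, map_mul, map_sub]
  field_simp
  ring

theorem ratDeriv_mul (f g : RatFunc C) :
    ratDeriv (f * g) = f * ratDeriv g + g * ratDeriv f := by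
  have hf : algebraMap C[X] (RatFunc C) f.denom ≠ 0 :=
    RatFunc.algebraMap_ne_zero f.denom_ne_zero
  have hg : algebraMap C[X] (RatFunc C) g.denom ≠ 0 :=
    RatFunc.algebraMap_ne_zero g.denom_ne_zero
  have h : f * g = algebraMap C[X] (RatFunc C) (f.num * g.num) /
      algebraMap C[X] (RatFunc C) (f.denom * g.denom) := by
    conv_lhs => rw [← RatFunc.num_div_denom f, ← RatFunc.num_div_denom g]
    rw [div_mul_div_comm, map_mul, map_mul]
  have h2 : f * ratDeriv g + g * ratDeriv f =
      algebraMap C[X] (RatFunc C) f.num / algebraMap C[X] (RatFunc C) f.denom * ratDeriv g +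
      algebraMap C[X] (RatFunc C) g.num / algebraMap C[X] (RatFunc C) g.denom * ratDeriv f := by
    rw [RatFunc.num_div_denom, RatFunc.num_div_denom]
  rw [h2, h, ratDeriv_div _ _ (mul_ne_zero f.denom_ne_zero g.denom_ne_zero)]
  unfold ratDeriv
  simp only [derivative_mul, map_add, map_mul, map_sub]
  field_simp
  ring

/-- The canonical `ℤ`-algebra structure of `C(x)`, the one over which `Differential` is stated. -/
instance ratIntAlgebra : Algebra ℤ (RatFunc C) := Ring.toIntAlgebra _

/-- `C(x)` with the derivation `d/dx`. -/
instance ratDifferential : Differential (RatFunc C) :=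
  mkDifferential ratDeriv ratDeriv_add ratDeriv_mul

theorem rat_deriv_eq (f : RatFunc C) : f′ = ratDeriv f := rfl

theorem laurentDeriv_coeff (f : LaurentSeries C) (n : ℤ) :
    (LaurentSeries.derivative C f).coeff n = ((n + 1 : ℤ) : C) * f.coeff (n + 1) := by
  rw [LaurentSeries.derivative_apply, LaurentSeries.hasseDeriv_coeff]
  simp

theorem laurentDeriv_mul (f g : LaurentSeries C) :
    LaurentSeries.derivative C (f * g) =
      f * LaurentSeries.derivative C g + g * LaurentSeries.derivative C f := by
  have key : ∀ f : LaurentSeries C, ∀ n : ℤ,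
      (HahnSeries.single (1 : ℤ) (1 : C) * LaurentSeries.derivative C f).coeff n
        = (n : C) * f.coeff n := by
    intro f n
    rw [HahnSeries.coeff_single_mul, laurentDeriv_coeff]
    simp
  have hsupp : ∀ f : LaurentSeries C,
      (HahnSeries.single (1 : ℤ) (1 : C) * LaurentSeries.derivative C f).support ⊆ f.support := by
    intro f n hn
    rw [HahnSeries.mem_support, key] at hn
    exact right_ne_zero_of_mul hn
  have hs : (HahnSeries.single (1 : ℤ) (1 : C)) ≠ 0 := by simp
  apply mul_left_cancel₀ hs
  have e : HahnSeries.single (1 : ℤ) (1 : C) * (f * LaurentSeries.derivative C g +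
      g * LaurentSeries.derivative C f) =
      f * (HahnSeries.single (1 : ℤ) (1 : C) * LaurentSeries.derivative C g) +
      (HahnSeries.single (1 : ℤ) (1 : C) * LaurentSeries.derivative C f) * g := by ring
  rw [e]
  ext n
  rw [key, HahnSeries.coeff_add, HahnSeries.coeff_mul,
    HahnSeries.coeff_mul_right' g.isPWO_support (hsupp g),
    HahnSeries.coeff_mul_left' f.isPWO_support (hsupp f), Finset.mul_sum, ← Finset.sum_add_distrib]
  refine Finset.sum_congr rfl fun ij hij => ?_
  rw [key, key]
  have : ij.1 + ij.2 = n := by simpa using (Finset.mem_antidiagonal.1 hij).2.2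
  rw [← this]
  push_cast
  ring

/-- The canonical `ℤ`-algebra structure of `C((x))`, the one over which `Differential` is stated. -/
instance laurentIntAlgebra : Algebra ℤ (LaurentSeries C) := Ring.toIntAlgebra _

/-- `C((x))` with the termwise derivation `d/dx`. -/
instance laurentDifferential : Differential (LaurentSeries C) :=
  mkDifferential (LaurentSeries.derivative C) (map_add _) laurentDeriv_mul

theorem laurent_deriv_eq (f : LaurentSeries C) : f′ = LaurentSeries.derivative C f := rfl

/-- The coefficientwise `C`-algebra structure of `C((x))`. -/
instance laurentAlgebra : Algebra C (LaurentSeries C) := HahnSeries.instAlgebra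

/-- The inclusion of `C(x)` in `C((x))` by series expansion at `0`. -/
instance ratLaurentAlgebra : Algebra (RatFunc C) (LaurentSeries C) :=
  RatFunc.liftAlgebra C (LaurentSeries C)

instance ratLaurentTower : IsScalarTower C (RatFunc C) (LaurentSeries C) :=
  IsScalarTower.of_algebraMap_eq fun c => by
    rw [IsScalarTower.algebraMap_apply C C[X] (RatFunc C),
      ← IsScalarTower.algebraMap_apply C[X] (RatFunc C) (LaurentSeries C)]
    simp only [Polynomial.algebraMap_hahnSeries_apply, Polynomial.algebraMap_eq,
      Polynomial.coe_C, HahnSeries.ofPowerSeries_C]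
    exact HahnSeries.algebraMap_apply

instance ratLaurentDifferentialAlgebra : DifferentialAlgebra (RatFunc C) (LaurentSeries C) where
  deriv_algebraMap f := by
    have hp : ∀ p : C[X], (algebraMap C[X] (LaurentSeries C) p)′ =
        algebraMap C[X] (LaurentSeries C) (derivative p) := by
      intro p
      ext n
      rw [laurent_deriv_eq, laurentDeriv_coeff]
      simp only [Polynomial.algebraMap_hahnSeries_apply]
      rw [PowerSeries.coeff_coe, PowerSeries.coeff_coe]
      rcases lt_trichotomy n (-1) with hn | rfl | hn
      · rw [if_pos (by omega), if_pos (by omega), mul_zero]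
      · simp
      · obtain ⟨m, rfl⟩ := Int.eq_ofNat_of_zero_le (by omega : 0 ≤ n)
        rw [if_neg (by omega), if_neg (by omega)]
        have h1 : ((m : ℤ) + 1).natAbs = m + 1 := by omega
        rw [h1, Int.natAbs_natCast, Polynomial.coeff_coe, Polynomial.coeff_coe, coeff_derivative]
        push_cast
        ring
    have hd : algebraMap C[X] (LaurentSeries C) f.denom ≠ 0 := by
      rw [IsScalarTower.algebraMap_apply C[X] (RatFunc C) (LaurentSeries C)]
      simpa using f.denom_ne_zero
    conv_lhs => rw [← RatFunc.num_div_denom f]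
    rw [rat_deriv_eq, ratDeriv, RatFunc.algebraMap_apply_div, Derivation.leibniz_div, hp, hp,
      map_div₀, map_pow, ← IsScalarTower.algebraMap_apply, ← IsScalarTower.algebraMap_apply]
    simp only [map_sub, map_mul, smul_eq_mul]
    field_simp

/-! ### Linear differential operators -/

/-- An operator `ℓ₀ + ℓ₁ D + ⋯ + ℓᵣ Dʳ` in `C(x)[D]`, stored as the list of its left coefficients:
`symbol` is `ℓ₀ + ℓ₁ X + ⋯ + ℓᵣ Xʳ`. The (noncommutative) product is defined below; it is not the
product of the symbols. -/
@[ext]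
structure DiffOp (C : Type u) [Field C] where
  symbol : (RatFunc C)[X]

namespace DiffOp

/-- The coefficient of `Dⁱ`. -/
def coeff (L : DiffOp C) (i : ℕ) : RatFunc C := L.symbol.coeff i

/-- The order of a nonzero operator (and `0` for the zero operator). -/
def ord (L : DiffOp C) : ℕ := L.symbol.natDegree

instance : Zero (DiffOp C) := ⟨⟨0⟩⟩

instance : One (DiffOp C) := ⟨⟨1⟩⟩

/-- The operator `D`. -/
def D : DiffOp C := ⟨X⟩

/-- The symbol of `D * L`: by `D a = a D + a'`, it is `X * p` plus the coefficientwise derivative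
of the symbol `p` of `L`. -/
def derivComp (p : (RatFunc C)[X]) : (RatFunc C)[X] := X * p + Differential.mapCoeffs p

/-- The product of `C(x)[D]`: `(∑ aᵢ Dⁱ) * L = ∑ aᵢ (Dⁱ * L)`. -/
instance : Mul (DiffOp C) where
  mul A L := ⟨A.symbol.sum fun i a => Polynomial.C a * derivComp^[i] L.symbol⟩

/-- `P` is a right factor of `M`. -/
def IsRightFactor (P M : DiffOp C) : Prop := ∃ A : DiffOp C, M = A * P

section Action

variable {F : Type*} [CommRing F] [Algebra (RatFunc C) F] [Differential F]

/-- The application `L · f = ℓ₀ f + ℓ₁ f' + ⋯ + ℓᵣ f⁽ʳ⁾` of an operator to an element of a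
differential ring over `C(x)`. -/
def apply (L : DiffOp C) (f : F) : F :=
  L.symbol.sum fun i a => algebraMap (RatFunc C) F a * (fun g : F => g′)^[i] f

theorem iterate_deriv_add (i : ℕ) (f g : F) :
    (fun g : F => g′)^[i] (f + g) = (fun g : F => g′)^[i] f + (fun g : F => g′)^[i] g := by
  induction i with
  | zero => rfl
  | succ n ih => simp only [Function.iterate_succ', Function.comp_apply, ih, map_add]

theorem iterate_deriv_zero (i : ℕ) : (fun g : F => g′)^[i] 0 = 0 := by
  induction i with
  | zero => rfl
  | succ n ih => simp only [Function.iterate_succ', Function.comp_apply, ih, map_zero]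

variable [DifferentialAlgebra (RatFunc C) F] [Algebra C F] [IsScalarTower C (RatFunc C) F]

theorem deriv_smul_const (c : C) (f : F) : (c • f)′ = c • f′ := by
  have h0 : (algebraMap C (RatFunc C) c)′ = 0 := by
    have h := ratDeriv_div (Polynomial.C c) 1 one_ne_zero
    rw [rat_deriv_eq, IsScalarTower.algebraMap_apply C C[X] (RatFunc C)]
    simpa using h
  have h1 : (algebraMap C F c)′ = 0 := by
    rw [IsScalarTower.algebraMap_apply C (RatFunc C) F, deriv_algebraMap, h0, map_zero]
  rw [Algebra.smul_def, Algebra.smul_def, Derivation.leibniz, h1]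
  simp

theorem iterate_deriv_smul (i : ℕ) (c : C) (f : F) :
    (fun g : F => g′)^[i] (c • f) = c • (fun g : F => g′)^[i] f := by
  induction i with
  | zero => rfl
  | succ n ih => simp only [Function.iterate_succ', Function.comp_apply, ih, deriv_smul_const]

variable (F) in
/-- The solution space `V_F(L)`, a `C`-vector space. -/
def solutionSpace (L : DiffOp C) : Submodule C F where
  carrier := {f | L.apply f = 0}
  zero_mem' := by
    simp only [Set.mem_ofPred_eq, apply, iterate_deriv_zero, mul_zero, Polynomial.sum_def,
      Finset.sum_const_zero]
  add_mem' := by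
    intro f g hf hg
    simp only [Set.mem_ofPred_eq, apply, Polynomial.sum_def] at *
    simp only [iterate_deriv_add, mul_add, Finset.sum_add_distrib, hf, hg, add_zero]
  smul_mem' := by
    intro c f hf
    simp only [Set.mem_ofPred_eq, apply, Polynomial.sum_def] at *
    simp only [iterate_deriv_smul, mul_smul_comm, ← Finset.smul_sum, hf, smul_zero]

end Action

/-- `Q` is primitive: its coefficients are coprime polynomials, normalized so that the leading
coefficient is monic. -/
def IsPrimitive (Q : DiffOp C) : Prop :=
  ∃ q : C[X][X], q.map (algebraMap C[X] (RatFunc C)) = Q.symbol ∧ q.IsPrimitive ∧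
    q.leadingCoeff.Monic

/-! ### Symmetric products -/

/-- In every differential ring over `C(x)`, `N` annihilates all products of a solution of `L₁` and
a solution of `L₂`. -/
def AnnihilatesProducts (L₁ L₂ N : DiffOp C) : Prop :=
  ∀ (F : Type u) [CommRing F] [Algebra (RatFunc C) F] [Differential F]
    [DifferentialAlgebra (RatFunc C) F] (f₁ f₂ : F),
    L₁.apply f₁ = 0 → L₂.apply f₂ = 0 → N.apply (f₁ * f₂) = 0

/-- `P` is the symmetric product of `L₁` and `L₂`: the primitive operator of lowest order that
annihilates all products of solutions. -/
def IsSymProd (L₁ L₂ P : DiffOp C) : Prop :=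
  P.IsPrimitive ∧ AnnihilatesProducts L₁ L₂ P ∧
    ∀ N : DiffOp C, N ≠ 0 → AnnihilatesProducts L₁ L₂ N → P.ord ≤ N.ord

open Classical in
/-- The symmetric product `L₁ ⊗ L₂` of two nonzero operators. -/
def symProd (L₁ L₂ : DiffOp C) : DiffOp C :=
  if h : ∃ P, IsSymProd L₁ L₂ P then h.choose else 0

/-- The symmetric power `L^{⊗ s}`; the empty symmetric product is `D`, whose solutions are the
constants. -/
def symPow (L : DiffOp C) : ℕ → DiffOp C
  | 0 => D
  | s + 1 => symProd (symPow L s) L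

/-! ### Ordinary points and translation -/

/-- `ξ` is an ordinary point of `L`: no `ℓᵢ / ℓᵣ` has a pole at `ξ`. -/
def IsOrdinaryPoint (ξ : C) (L : DiffOp C) : Prop :=
  ∀ i, ((L.coeff i / L.coeff L.ord).denom).eval ξ ≠ 0

/-- The substitution `x ↦ x + ξ` on `C(x)`. -/
def ratShift (ξ : C) : RatFunc C →+* RatFunc C :=
  RatFunc.mapRingHom (algEquivAevalXAddC ξ)
    (nonZeroDivisors_le_comap_nonZeroDivisors_of_injective _ (algEquivAevalXAddC ξ).injective)

/-- The substitution `x ↦ x + ξ` on `C(x)[D]`. -/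
def shift (ξ : C) (L : DiffOp C) : DiffOp C := ⟨L.symbol.map (ratShift ξ)⟩

/-! ### Operators with only algebraic solutions -/

/-- `L` has only algebraic solutions: in some finite extension field `E` of `C(x)`, with the
derivation extending `d/dx`, the solution space of `L` has dimension `ord L`. -/
def HasOnlyAlgebraicSolutions (L : DiffOp C) : Prop :=
  ∃ (E : Type u) (_ : Field E) (_ : Algebra (RatFunc C) E) (_ : FiniteDimensional (RatFunc C) E)
    (_ : Differential E) (_ : DifferentialAlgebra (RatFunc C) E) (_ : Algebra C E)
    (_ : IsScalarTower C (RatFunc C) E),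
    Module.rank C (L.solutionSpace E) = L.ord

/-! ### Quotients and colon spaces -/

/-- `Q` is a (global) quasi-symmetric quotient of `M` by `L`: a primitive operator of maximal order
such that `L ⊗ Q` is a right factor of `M`. -/
def IsQuasiSymmetricQuotient (M L Q : DiffOp C) : Prop :=
  Q.IsPrimitive ∧ IsRightFactor (symProd L Q) M ∧
    ∀ P : DiffOp C, P ≠ 0 → IsRightFactor (symProd L P) M → P.ord ≤ Q.ord

/-- The colon space `(V(M) : V(L)) = {h | h V(L) ⊆ V(M)}` in `C((x))`. -/
def colonSpace (M L : DiffOp C) : Submodule C (LaurentSeries C) :=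
  M.solutionSpace (LaurentSeries C) / L.solutionSpace (LaurentSeries C)

/-! ### Indicial polynomials -/

/-- For `N = ∑ c_{i,j} xʲ Dⁱ` in `C[x][D]`, the polynomial in `s` by which `x^{s+e}` is multiplied
in `N · xˢ`, that is `∑ᵢ c_{i,i+e} s(s-1)⋯(s-i+1)`. -/
def monomialAction (N : DiffOp C) (e : ℤ) : C[X] :=
  ∑ i ∈ Finset.range (N.ord + 1),
    if 0 ≤ (i : ℤ) + e then
      Polynomial.C ((N.coeff i).num.coeff ((i : ℤ) + e).toNat) * descPochhammer C i
    else 0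

/-- The indicial polynomial of `N` at `0`: the first nonzero one of the polynomials above. -/
def indicialPoly (N : DiffOp C) : C[X] := N.monomialAction (sInf {e | N.monomialAction e ≠ 0})

/-- The set `Z_N` of nonnegative integer roots of the indicial polynomial. -/
def indicialRoots (N : DiffOp C) : Set ℕ := {k | (N.indicialPoly).eval (k : C) = 0}

end DiffOp

/-! ### The local algorithm, for operators with ordinary point `0` -/

open DiffOp

/-- The truncation `T_k f`, keeping the terms of degree at most `k`. -/
def truncate (k : ℤ) (f : LaurentSeries C) : LaurentSeries C := HahnSeries.truncLT (k + 1) f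

/-- Specification of `ColonSpaceBasis(M, L, k)`: the `h j` are the truncations at precision `k` of a
basis of the colon space. -/
def IsColonSpaceBasis (M L : DiffOp C) (k : ℤ) {δ : ℕ} (h : Fin δ → LaurentSeries C) : Prop :=
  ∃ b : Module.Basis (Fin δ) C (colonSpace M L), ∀ j, h j = truncate k (b j : LaurentSeries C)

/-- Specification of `BoundDegreeOfQuasiSymmetricQuotientCoeffs(M, L, δ)`: `d₀` bounds the degrees
of the coefficients of the quasi-symmetric quotient of `M` by `L`, if that has order `δ`. -/
def IsQuotientDegreeBound (M L : DiffOp C) (δ d₀ : ℕ) : Prop :=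
  ∀ Q : DiffOp C, IsQuasiSymmetricQuotient M L Q → Q.ord = δ →
    ∀ i, (Q.coeff i).num.natDegree ≤ d₀

/-- `Q = q₀ + ⋯ + q_δ D^δ` is primitive with `deg qᵢ ≤ d` and `Q · h j = O(x^{k-δ})` for all `j`. -/
def IsApproximantAnnihilator {δ : ℕ} (h : Fin δ → LaurentSeries C) (d k : ℤ) (Q : DiffOp C) :
    Prop :=
  Q.IsPrimitive ∧ Q.ord ≤ δ ∧ (∀ i ≤ δ, ((Q.coeff i).num.natDegree : ℤ) ≤ d) ∧
    ∀ j, ∀ m < k - δ, (Q.apply (h j)).coeff m = 0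

/-- Specification of `ApproximantAnnihilator(h; d, …, d; k)`: it returns some operator as above, or
`∅` (here `none`) if there is no such operator. -/
def ApproximantAnnihilatorReturns {δ : ℕ} (h : Fin δ → LaurentSeries C) (d k : ℤ) :
    Option (DiffOp C) → Prop
  | none => ∀ Q, ¬ IsApproximantAnnihilator h d k Q
  | some Q => IsApproximantAnnihilator h d k Q

/-- The degree bound `min (d₀, ⌊(k-δ)/(δ+1)⌋)` used at precision `k`. -/
def degreeBoundAt (δ d₀ : ℕ) (k : ℤ) : ℤ := min (d₀ : ℤ) ((k - δ) / (δ + 1))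

/-- The acceptance test for a candidate `Q`: `ord Q = δ` and `L ⊗ Q` is a right factor of `M`. -/
def Accepts (M L : DiffOp C) (δ : ℕ) (Q : DiffOp C) : Prop :=
  Q.ord = δ ∧ IsRightFactor (symProd L Q) M

/-- The condition for giving up: no candidate although `k ≥ (δ+1)(d₀+1)+δ`. -/
def GivesUp (δ d₀ : ℕ) (k : ℤ) (a : Option (DiffOp C)) : Prop :=
  a = none ∧ ((δ : ℤ) + 1) * (d₀ + 1) + δ ≤ k

/-- Control states of the local algorithm: the start, the head of the `while` loop with the current
values of the variables `δ`, `d₀`, `k`, and termination with an output (`none` stands for the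
answer *None*). -/
inductive LocalState (C : Type u) [Field C]
  | start : LocalState C
  | loop (δ d₀ : ℕ) (k : ℤ) : LocalState C
  | done (out : Option (DiffOp C)) : LocalState C

/-- One step of `QuasiSymmetricQuotientAtZero(M, L)`. The values returned by the subroutines are
arbitrary values that meet their specifications. -/
inductive LocalStep (M L : DiffOp C) : LocalState C → LocalState C → Prop
  | zeroDim :
      Module.finrank C (colonSpace M L) = 0 →
      LocalStep M L .start (.done (some 1))
  | init (m d₀ : ℕ) :
      0 < Module.finrank C (colonSpace M L) →
      IsGreatest (symProd M (symPow L (L.ord - 1))).indicialRoots m →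
      IsQuotientDegreeBound M L (Module.finrank C (colonSpace M L)) d₀ →
      LocalStep M L .start
        (.loop (Module.finrank C (colonSpace M L)) d₀
          ((m : ℤ) - (L.ord * (L.ord - 1) / 2 : ℕ) + 1))
  | giveUp (δ d₀ : ℕ) (k : ℤ) (h : Fin δ → LaurentSeries C) (a : Option (DiffOp C)) :
      IsColonSpaceBasis M L k h →
      ApproximantAnnihilatorReturns h (degreeBoundAt δ d₀ k) k a →
      GivesUp δ d₀ k a →
      LocalStep M L (.loop δ d₀ k) (.done none)
  | accept (δ d₀ : ℕ) (k : ℤ) (h : Fin δ → LaurentSeries C) (Q : DiffOp C) :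
      IsColonSpaceBasis M L k h →
      ApproximantAnnihilatorReturns h (degreeBoundAt δ d₀ k) k (some Q) →
      Accepts M L δ Q →
      LocalStep M L (.loop δ d₀ k) (.done (some Q))
  | double (δ d₀ : ℕ) (k : ℤ) (h : Fin δ → LaurentSeries C) (a : Option (DiffOp C)) :
      IsColonSpaceBasis M L k h →
      ApproximantAnnihilatorReturns h (degreeBoundAt δ d₀ k) k a →
      ¬ GivesUp δ d₀ k a →
      (∀ Q, a = some Q → ¬ Accepts M L δ Q) →
      LocalStep M L (.loop δ d₀ k) (.loop δ d₀ (2 * k))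

/-! ### The global algorithm -/

/-- Control states of the global algorithm: the start, a state of the local algorithm called after
the translation by `ξ`, and termination with an output (`none` stands for the answer *Fail*). -/
inductive GlobalState (C : Type u) [Field C]
  | start : GlobalState C
  | call (ξ : C) (s : LocalState C) : GlobalState C
  | done (out : Option (DiffOp C)) : GlobalState C

/-- One step of `QuasiSymmetricQuotient(M, L)`: choose an arbitrary ordinary point `ξ` of `L` and
`M`, run the local algorithm on the operators translated by `x ↦ x + ξ`, and translate its answer
back by `x ↦ x - ξ`, or fail. -/
inductive GlobalStep (M L : DiffOp C) : GlobalState C → GlobalState C → Prop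
  | choose (ξ : C) :
      IsOrdinaryPoint ξ L → IsOrdinaryPoint ξ M →
      GlobalStep M L .start (.call ξ .start)
  | inner (ξ : C) (s t : LocalState C) :
      LocalStep (M.shift ξ) (L.shift ξ) s t →
      GlobalStep M L (.call ξ s) (.call ξ t)
  | fail (ξ : C) : GlobalStep M L (.call ξ (.done none)) (.done none)
  | success (ξ : C) (Q : DiffOp C) :
      GlobalStep M L (.call ξ (.done (some Q))) (.done (some (Q.shift (-ξ))))

/-- The global algorithm on input `(M, L)` returns `out`, whatever choices are made: there is no
infinite run, and every run from the start that has not ended in the output `out` can be continued.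
In other words, every maximal run is finite and ends in the output `out`. -/
def AlgorithmReturns (M L : DiffOp C) (out : Option (DiffOp C)) : Prop :=
  (¬ ∃ run : ℕ → GlobalState C, run 0 = .start ∧ ∀ n, GlobalStep M L (run n) (run (n + 1))) ∧
    ∀ s, Relation.ReflTransGen (GlobalStep M L) .start s →
      s = .done out ∨ ∃ t, GlobalStep M L s t

end SymDiv

end

/-! Let `f` be a solution of `L` and `r` its order. Repeated use of `L f = 0` turns `M (f y)` into
`∑ i < r, f⁽ⁱ⁾ (N i) y`, with operators `N i` that depend on neither `f` nor `y` nor the ring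
(`exists_op_mul_eq`). If `f` runs through `r` independent solutions, their Wronskian matrix is
invertible, so `M` kills all the products `f y` exactly when every `N i` kills `y`. Let `Q` be the
primitive greatest common right divisor of the `N i` (`exists_isColonOperator`). Being a right
multiple of `L ⊗ P` amounts to annihilating the products of solutions of `L` and `P`
(`isRightFactor_symProd_iff`), so `L ⊗ P` is a right factor of `M` iff `P` is a right factor of `Q`.
Hence `Q` is the unique quasi-symmetric quotient.

At an ordinary point the colon space in `C((x))` is the solution space of `Q`, and its dimension is
the full `Q.ord` (`finrank_colonSpace`). Indeed, fix a solution `f₀ ≠ 0` of `L`. Then `M (f₀ y) = b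
(Q y)` for an operator `b` over `C((x))` of order at most `M.ord - Q.ord`. Thus `Q` maps the space
`f₀⁻¹ V(M)`, of dimension `M.ord`, into the solutions of `b`, and the kernel has dimension at least
`Q.ord`.

So the algorithm searches for an operator of the right order. An accepted candidate has order
`Q.ord` and passes the divisibility test, so it is `Q`; giving up is impossible, because `Q` itself
is an approximant once the degree bound reaches `d₀`. The starting precision is positive, since a
product of solutions of prescribed orders shows `r (r - 1) / 2 ∈ Z_N`; so doubling makes it grow.
For large precision a bounded-degree approximant annihilates the whole colon space
(`exists_precision_bound`), which makes it a right multiple of `Q` of no larger order, that is, `Q`.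
Invariants and accessibility carry this to all runs, and translation by `ξ` to all ordinary points.
-/

open Polynomial
open scoped Differential

noncomputable section

namespace SymDiv

/-! ### Linear differential operators over a differential field -/

/-- The iterated derivative. -/
def nd {F : Type*} [CommRing F] [Differential F] (i : ℕ) (f : F) : F := (fun g : F => g′)^[i] f

section IteratedDerivative

variable {F : Type*} [CommRing F] [Differential F]

@[simp] theorem nd_zero (f : F) : nd 0 f = f := rfl

theorem nd_succ (i : ℕ) (f : F) : nd (i + 1) f = (nd i f)′ :=
  Function.iterate_succ_apply' _ _ _

theorem nd_add (i : ℕ) (f g : F) : nd i (f + g) = nd i f + nd i g := by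
  induction i with
  | zero => rfl
  | succ n ih => simp only [nd_succ, ih, map_add]

theorem nd_mul_const (i : ℕ) {c : F} (hc : c′ = 0) (f : F) : nd i (c * f) = c * nd i f := by
  induction i with
  | zero => rfl
  | succ n ih => simp [nd_succ, ih, hc]

theorem nd_zero_right (i : ℕ) : nd i (0 : F) = 0 := by
  induction i with
  | zero => rfl
  | succ n ih => simp [nd_succ, ih]

end IteratedDerivative

section Application

variable {k : Type*} [Field k] {F : Type*} [CommRing F] [Algebra k F] [Differential F]

/-- The application of an operator to an element of a differential ring. -/
def op (p : k[X]) (f : F) : F := p.sum fun i a => algebraMap k F a * nd i f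

theorem op_add (p q : k[X]) (f : F) : op (p + q) f = op p f + op q f :=
  sum_add_index _ _ _ (by simp) (by intros; simp [add_mul])

theorem op_monomial (n : ℕ) (c : k) (f : F) : op (monomial n c) f = algebraMap k F c * nd n f :=
  sum_monomial_index _ _ (by simp)

theorem op_C_mul (c : k) (p : k[X]) (f : F) :
    op (Polynomial.C c * p) f = algebraMap k F c * op p f := by
  induction p using Polynomial.induction_on' with
  | add p q hp hq => rw [mul_add, op_add, op_add, hp, hq, mul_add]
  | monomial n a => rw [C_mul_monomial, op_monomial, op_monomial, map_mul, mul_assoc]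

@[simp] theorem op_zero (f : F) : op (0 : k[X]) f = 0 := by simp [op]

@[simp] theorem op_one (f : F) : op (1 : k[X]) f = f := by
  rw [← monomial_zero_one, op_monomial]; simp

theorem op_X_pow (j : ℕ) (f : F) : op (X ^ j : k[X]) f = nd j f := by
  rw [← monomial_one_right_eq_X_pow, op_monomial]; simp

theorem op_sum {ι : Type*} (s : Finset ι) (p : ι → k[X]) (f : F) :
    op (∑ i ∈ s, p i) f = ∑ i ∈ s, op (p i) f :=
  map_sum (AddMonoidHom.mk' (fun p : k[X] => op p f) fun p q => op_add p q f) p s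

theorem op_eq_sum_range {p : k[X]} {n : ℕ} (hp : p.natDegree < n) (f : F) :
    op p f = ∑ i ∈ Finset.range n, algebraMap k F (p.coeff i) * nd i f :=
  sum_over_range' p (by simp) n hp

theorem op_eq_sum_range_of_degree_lt {p : k[X]} {n : ℕ} (hp : p.degree < n) (f : F) :
    op p f = ∑ i ∈ Finset.range n, algebraMap k F (p.coeff i) * nd i f := by
  by_cases h : p = 0
  · simp [h]
  · exact op_eq_sum_range ((natDegree_lt_iff_degree_lt h).2 hp) f

theorem op_add_right (p : k[X]) (f g : F) : op p (f + g) = op p f + op p g := by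
  simp [op, Polynomial.sum_def, nd_add, mul_add, Finset.sum_add_distrib]

theorem op_const_mul (p : k[X]) {c : F} (hc : c′ = 0) (f : F) : op p (c * f) = c * op p f := by
  simp only [op, Polynomial.sum_def, nd_mul_const _ hc, Finset.mul_sum]
  exact Finset.sum_congr rfl fun _ _ => by ring

@[simp] theorem op_zero_right (p : k[X]) : op p (0 : F) = 0 := by
  simp [op, Polynomial.sum_def, nd_zero_right]

end Application

/-- Lets operators over `C(x)` be combined with coefficients from `C((x))` in `finrank_colonSpace`.
-/
theorem op_map {k K : Type*} [Field k] [Field K] [Algebra k K] {F : Type*} [CommRing F]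
    [Differential F] [Algebra k F] [Algebra K F] [IsScalarTower k K F] (p : k[X]) (f : F) :
    op (p.map (algebraMap k K)) f = op p f := by
  induction p using Polynomial.induction_on' with
  | add p q hp hq => rw [Polynomial.map_add, op_add, op_add, hp, hq]
  | monomial n c =>
    rw [map_monomial, op_monomial, op_monomial, ← IsScalarTower.algebraMap_apply]

section Generic

variable {k : Type*} [Field k] [Differential k]

/-- Left multiplication by `D` on the symbols of operators. -/
def dX (p : k[X]) : k[X] := X * p + Differential.mapCoeffs p

theorem coeff_dX_succ (p : k[X]) (n : ℕ) :
    (dX p).coeff (n + 1) = p.coeff n + (p.coeff (n + 1))′ := by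
  simp [dX, Differential.coeff_mapCoeffs]

theorem dX_add (p q : k[X]) : dX (p + q) = dX p + dX q := by
  simp only [dX, mul_add, map_add]; ring

theorem dX_monomial (n : ℕ) (a : k) :
    dX (monomial n a) = monomial (n + 1) a + monomial n a′ := by
  simp [dX, Differential.mapCoeffs_monomial, X_mul_monomial]

theorem iterate_dX_bound {p : k[X]} {n : ℕ} (hp : p.natDegree ≤ n) (i : ℕ) :
    (dX^[i] p).natDegree ≤ n + i ∧ (dX^[i] p).coeff (n + i) = p.coeff n := by
  induction i with
  | zero => exact ⟨hp, rfl⟩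
  | succ i ih =>
    rw [Function.iterate_succ_apply']
    refine ⟨natDegree_le_iff_coeff_eq_zero.2 fun m hm => ?_, ?_⟩
    · obtain ⟨m, rfl⟩ : ∃ m', m = m' + 1 := ⟨m - 1, by omega⟩
      rw [coeff_dX_succ, coeff_eq_zero_of_natDegree_lt (by omega),
        coeff_eq_zero_of_natDegree_lt (by omega)]
      simp
    · rw [← add_assoc, coeff_dX_succ, ih.2,
        coeff_eq_zero_of_natDegree_lt (Nat.lt_succ_of_le ih.1)]
      simp

/-- The product of `k[D]` on symbols. -/
def opMul (a p : k[X]) : k[X] := a.sum fun i c => Polynomial.C c * dX^[i] p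

theorem opMul_add (a b p : k[X]) : opMul (a + b) p = opMul a p + opMul b p :=
  sum_add_index _ _ _ (by simp) (by intros; simp [add_mul])

theorem opMul_monomial (n : ℕ) (c : k) (p : k[X]) :
    opMul (monomial n c) p = Polynomial.C c * dX^[n] p :=
  sum_monomial_index _ _ (by simp)

theorem opMul_zero_left (p : k[X]) : opMul 0 p = 0 := by simp [opMul]

theorem opMul_C (c : k) (p : k[X]) : opMul (Polynomial.C c) p = Polynomial.C c * p := by
  rw [← monomial_zero_left, opMul_monomial]; simp

theorem coeff_opMul_top (b p : k[X]) :
    (opMul b p).coeff (p.natDegree + b.natDegree) = b.leadingCoeff * p.leadingCoeff := by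
  rw [opMul, sum_over_range _ (by simp), finsetSum_coeff, Finset.sum_range_succ,
    Finset.sum_eq_zero, zero_add, coeff_C_mul, (iterate_dX_bound le_rfl _).2]
  · rfl
  · intro i hi
    rw [coeff_C_mul, coeff_eq_zero_of_natDegree_lt (p := dX^[i] p), mul_zero]
    have := (iterate_dX_bound (le_refl p.natDegree) i).1
    have := Finset.mem_range.1 hi
    omega

/-- The leading coefficients multiply to something nonzero, because differentiating coefficients
never affects the top term. -/
theorem natDegree_add_le_of_opMul {b p : k[X]} (hb : b ≠ 0) (hp : p ≠ 0) :
    p.natDegree + b.natDegree ≤ (opMul b p).natDegree := by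
  apply le_natDegree_of_ne_zero
  rw [coeff_opMul_top]
  exact mul_ne_zero (leadingCoeff_ne_zero.2 hb) (leadingCoeff_ne_zero.2 hp)

/-- Right division with remainder. -/
theorem exists_eq_opMul_add (a : k[X]) {p : k[X]} (hp : p ≠ 0) :
    ∃ b r, a = opMul b p + r ∧ r.degree < p.degree := by
  obtain ⟨N, hN⟩ : ∃ N : ℕ, a.degree < N := ⟨a.natDegree + 1, by
    exact lt_of_le_of_lt degree_le_natDegree (by exact_mod_cast Nat.lt_succ_self _)⟩
  induction N generalizing a with
  | zero =>
    have : a = 0 := by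
      rw [← degree_eq_bot]; exact Nat.WithBot.lt_zero_iff.1 (by simpa using hN)
    exact ⟨0, 0, by simp [this, opMul_zero_left], by
      rw [degree_zero]; exact bot_lt_iff_ne_bot.2 (degree_ne_bot.2 hp)⟩
  | succ N ih =>
    by_cases h : a.degree < p.degree
    · exact ⟨0, a, by simp [opMul_zero_left], h⟩
    by_cases ha : a = 0
    · exact absurd (by rw [ha, degree_zero]; exact bot_lt_iff_ne_bot.2 (degree_ne_bot.2 hp)) h
    have hpN : p.natDegree ≤ N := by
      have h1 := natDegree_le_natDegree (not_lt.1 h)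
      have h2 := (natDegree_lt_iff_degree_lt ha).2 hN
      omega
    have haN : a.natDegree ≤ N := by
      have h2 := (natDegree_lt_iff_degree_lt ha).2 hN
      omega
    set c := a.coeff N / p.leadingCoeff
    have hb := iterate_dX_bound (le_refl p.natDegree) (N - p.natDegree)
    have e : p.natDegree + (N - p.natDegree) = N := by omega
    rw [e] at hb
    obtain ⟨b, r, hbr, hr⟩ := ih (a - Polynomial.C c * dX^[N - p.natDegree] p) (by
      rw [degree_lt_iff_coeff_zero]
      intro m hm
      rcases hm.eq_or_lt with rfl | hm
      · rw [coeff_sub, coeff_C_mul, hb.2]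
        have : p.leadingCoeff ≠ 0 := leadingCoeff_ne_zero.2 hp
        change a.coeff N - a.coeff N / p.leadingCoeff * p.leadingCoeff = 0
        field_simp
        simp
      · rw [coeff_sub, coeff_C_mul, coeff_eq_zero_of_natDegree_lt (by omega),
          coeff_eq_zero_of_natDegree_lt (by omega)]
        simp)
    refine ⟨b + monomial (N - p.natDegree) c, r, ?_, hr⟩
    rw [opMul_add, opMul_monomial]
    linear_combination hbr

section Application

variable {F : Type*} [CommRing F] [Algebra k F] [Differential F]

variable [DifferentialAlgebra k F]

theorem op_dX (p : k[X]) (f : F) : op (dX p) f = (op p f)′ := by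
  induction p using Polynomial.induction_on' with
  | add p q hp hq => rw [dX_add, op_add, op_add, hp, hq, map_add]
  | monomial n a =>
    rw [dX_monomial, op_add, op_monomial, op_monomial, op_monomial, Derivation.leibniz, nd_succ,
      deriv_algebraMap]
    simp only [smul_eq_mul]
    ring

theorem op_iterate_dX (i : ℕ) (p : k[X]) (f : F) : op (dX^[i] p) f = nd i (op p f) := by
  induction i with
  | zero => rfl
  | succ i ih => rw [Function.iterate_succ_apply', op_dX, ih, nd_succ]

theorem op_opMul (a p : k[X]) (f : F) : op (opMul a p) f = op a (op p f) := by
  induction a using Polynomial.induction_on' with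
  | add a b ha hb => rw [opMul_add, op_add, op_add, ha, hb]
  | monomial n c => rw [opMul_monomial, op_C_mul, op_iterate_dX, op_monomial]

end Application

universe w

/-- A product with a solution `f` of `l`: `m · (f y) = ∑ f⁽ⁱ⁾ (Nᵢ · y)`. -/
theorem exists_op_mul_eq (l : k[X]) (hl : l ≠ 0) (m : k[X]) :
    ∃ N : ℕ → k[X], (∀ i, (N i).natDegree ≤ m.natDegree) ∧
      ∀ (F : Type w) [CommRing F] [Algebra k F] [Differential F] [DifferentialAlgebra k F]
        (f y : F), op l f = 0 →
        op m (f * y) = ∑ i ∈ Finset.range l.natDegree, nd i f * op (N i) y := by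
  set r := l.natDegree with hr
  have hlc : l.coeff r ≠ 0 := by rwa [hr, coeff_natDegree, leadingCoeff_ne_zero]
  have hred : ∀ (F : Type w) [CommRing F] [Algebra k F] [Differential F] (f : F), op l f = 0 →
      nd r f = ∑ i ∈ Finset.range r, algebraMap k F (-(l.coeff i / l.coeff r)) * nd i f := by
    intro F _ _ _ f hf
    rw [op_eq_sum_range (Nat.lt_succ_self _), Finset.sum_range_succ, ← hr] at hf
    have h2 : nd r f = algebraMap k F (l.coeff r)⁻¹ * (algebraMap k F (l.coeff r) * nd r f) := by
      rw [← mul_assoc, ← map_mul, inv_mul_cancel₀ hlc, map_one, one_mul]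
    rw [h2, eq_neg_of_add_eq_zero_right hf, mul_neg, Finset.mul_sum, ← Finset.sum_neg_distrib]
    refine Finset.sum_congr rfl fun i _ => ?_
    rw [← mul_assoc, ← map_mul, map_neg, neg_mul, div_eq_inv_mul]
  have key : ∀ j : ℕ, ∃ N : ℕ → k[X], (∀ i, (N i).natDegree ≤ j) ∧
      ∀ (F : Type w) [CommRing F] [Algebra k F] [Differential F] [DifferentialAlgebra k F]
        (f y : F), op l f = 0 →
        nd j (f * y) = ∑ i ∈ Finset.range r, nd i f * op (N i) y := by
    intro j
    induction j with
    | zero =>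
      -- For `r = 0` the relation `hred` reads `f = 0`, and the empty sum is correct.
      rcases Nat.eq_zero_or_pos r with h0 | h0
      · refine ⟨0, by simp, fun F _ _ _ _ f y hf => ?_⟩
        have := hred F f hf
        simp only [h0, Finset.range_zero, Finset.sum_empty, nd_zero] at this ⊢
        rw [this, zero_mul]
      · refine ⟨fun i => if i = 0 then 1 else 0, fun i => ?_, fun F _ _ _ _ f y hf => ?_⟩
        · dsimp only; split_ifs <;> simp
        · rw [Finset.sum_eq_single 0]
          · simp
          · intro b _ hb; simp [hb]
          · intro h; exact absurd (Finset.mem_range.2 h0) h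
    | succ j ih =>
      obtain ⟨N, hN, hNF⟩ := ih
      -- Differentiating `f⁽ⁱ⁾ (N i) y` gives `f⁽ⁱ⁾ D (N i) y + f⁽ⁱ⁺¹⁾ (N i) y`. The second terms
      -- shift the index by one, and the last of them, with `f⁽ʳ⁾`, is spread over all `i` by
      -- `hred`.
      refine ⟨fun i => dX (N i) + ((if i = 0 then 0 else N (i - 1)) +
        Polynomial.C (-(l.coeff i / l.coeff r)) * (if r = 0 then 0 else N (r - 1))),
        fun i => ?_, fun F _ _ _ _ f y hf => ?_⟩
      · refine natDegree_add_le_of_degree_le ?_ (natDegree_add_le_of_degree_le ?_ ?_)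
        · exact (iterate_dX_bound (hN i) 1).1
        · split_ifs
          · simp
          · exact (hN _).trans (Nat.le_succ _)
        · refine (natDegree_C_mul_le _ _).trans ?_
          split_ifs
          · simp
          · exact (hN _).trans (Nat.le_succ _)
      · have hr' := hred F f hf
        rw [nd_succ, hNF F f y hf, map_sum]
        simp only [Derivation.leibniz, smul_eq_mul, op_add, op_dX, op_C_mul, mul_add,
          Finset.sum_add_distrib, ← nd_succ]
        congr 1
        obtain _ | s := r
        · simp
        · have h1 : ∑ i ∈ Finset.range (s + 1), nd i f * op (if i = 0 then 0 else N (i - 1)) y =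
              ∑ i ∈ Finset.range s, op (N i) y * nd (i + 1) f := by
            rw [Finset.sum_range_succ']
            simp [mul_comm]
          rw [Finset.sum_range_succ, h1, hr', Finset.mul_sum]
          congr 1
          exact Finset.sum_congr rfl fun i _ => by simp; ring
  choose N hN hNF using key
  refine ⟨fun i => ∑ j ∈ Finset.range (m.natDegree + 1), Polynomial.C (m.coeff j) * N j i,
    fun i => ?_, fun F _ _ _ _ f y hf => ?_⟩
  · refine natDegree_sum_le_of_forall_le _ _ fun j hj => (natDegree_C_mul_le _ _).trans ?_
    exact (hN j i).trans (by have := Finset.mem_range.1 hj; omega)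
  · rw [op_eq_sum_range (Nat.lt_succ_self _)]
    simp only [hNF _ F f y hf, op_sum, op_C_mul, Finset.mul_sum]
    rw [Finset.sum_comm]
    exact Finset.sum_congr rfl fun i _ => Finset.sum_congr rfl fun j _ => by ring

end Generic

/-! ### Wronskians -/

section Wronskian

variable {C K : Type*} [Field C] [Field K] [Algebra C K] [Differential K]

/-- The classical Wronskian argument: scale a relation so that one coefficient is `1` and
differentiate it. The derivatives of the other coefficients satisfy a shorter relation, so they
vanish; all coefficients are then constants, against independence over `C`. -/
theorem nd_sum_mul_eq_zero (hC : ∀ f : K, f′ = 0 → ∃ c, algebraMap C K c = f)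
    {ι : Type*} [DecidableEq ι] {u : ι → K} (hu : LinearIndependent C u) (s : Finset ι) :
    ∀ c : ι → K, (∀ j, ∑ a ∈ s, c a * nd j (u a) = 0) → ∀ a ∈ s, c a = 0 := by
  induction s using Finset.induction_on with
  | empty => simp
  | insert b s hb ih =>
    intro c hc
    by_cases hcb : c b = 0
    · intro a ha
      rcases Finset.mem_insert.1 ha with rfl | ha
      · exact hcb
      · refine ih c (fun j => ?_) a ha
        have := hc j
        rwa [Finset.sum_insert hb, hcb, zero_mul, zero_add] at this
    · exfalso
      set e : ι → K := fun a => c a / c b with he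
      have heb : e b = 1 := div_self hcb
      have hej : ∀ j, ∑ a ∈ insert b s, e a * nd j (u a) = 0 := by
        intro j
        have := congrArg (fun z => (c b)⁻¹ * z) (hc j)
        simp only [Finset.mul_sum, mul_zero] at this
        rw [← this]
        exact Finset.sum_congr rfl fun a _ => by rw [he]; ring
      have hd : ∀ a ∈ s, (e a)′ = 0 := by
        refine ih (fun a => (e a)′) fun j => ?_
        have h1 := congrArg (fun z => z′) (hej j)
        simp only [map_sum, Derivation.leibniz, smul_eq_mul, map_zero, Finset.sum_add_distrib,
          ← nd_succ] at h1
        rw [hej (j + 1), zero_add, Finset.sum_insert hb, heb] at h1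
        simp only [Derivation.map_one_eq_zero, mul_zero, zero_add] at h1
        rw [← h1]
        exact Finset.sum_congr rfl fun a _ => mul_comm _ _
      have hd' : ∀ a ∈ insert b s, ∃ x, algebraMap C K x = e a := by
        intro a ha
        rcases Finset.mem_insert.1 ha with rfl | ha
        · exact ⟨1, by rw [heb, map_one]⟩
        · exact hC _ (hd a ha)
      choose! x hx using hd'
      have h0 := hej 0
      have h1 : ∑ a ∈ insert b s, x a • u a = 0 := by
        rw [← h0]
        exact Finset.sum_congr rfl fun a ha => by rw [Algebra.smul_def, hx a ha, nd_zero]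
      have h2 := linearIndependent_iff'.1 hu _ _ h1 b (Finset.mem_insert_self _ _)
      have h3 := hx b (Finset.mem_insert_self _ _)
      rw [h2, heb, map_zero] at h3
      exact zero_ne_one h3

variable {k : Type*} [Field k] [Differential k] [Algebra k K] [DifferentialAlgebra k K]

/-- The `r i` are the coefficients of the remainder of `Dʲ` on right division by `p`, hence common
to all solutions. -/
theorem exists_nd_eq_sum {p : k[X]} (hp : p ≠ 0) (j : ℕ) :
    ∃ r : ℕ → K, ∀ u : K, op p u = 0 →
      nd j u = ∑ i ∈ Finset.range p.natDegree, r i * nd i u := by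
  obtain ⟨b, r, hbr, hr⟩ := exists_eq_opMul_add (X ^ j) hp
  refine ⟨fun i => algebraMap k K (r.coeff i), fun u hu => ?_⟩
  rw [← op_X_pow (k := k), hbr, op_add, op_opMul, hu, op_zero_right, zero_add,
    op_eq_sum_range_of_degree_lt (hr.trans_le degree_le_natDegree)]

/-- The truncated Wronskian matrix of independent solutions has independent rows. -/
theorem linearIndependent_wronskian (hC : ∀ f : K, f′ = 0 → ∃ c, algebraMap C K c = f)
    {p : k[X]} (hp : p ≠ 0) {ι : Type*} [Fintype ι] {u : ι → K} (hu : LinearIndependent C u)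
    (hpu : ∀ a, op p (u a) = 0) :
    LinearIndependent K fun (a : ι) (i : Fin p.natDegree) => nd (i : ℕ) (u a) := by
  classical
  rw [Fintype.linearIndependent_iff]
  intro c hc a
  refine nd_sum_mul_eq_zero hC hu Finset.univ c (fun j => ?_) a (Finset.mem_univ a)
  obtain ⟨r, hr⟩ := exists_nd_eq_sum (K := K) hp j
  calc ∑ a, c a * nd j (u a)
      = ∑ i ∈ Finset.range p.natDegree, r i * ∑ a, c a * nd i (u a) := by
        simp only [hr _ (hpu _), Finset.mul_sum]
        rw [Finset.sum_comm]
        exact Finset.sum_congr rfl fun i _ => Finset.sum_congr rfl fun a _ => by ring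
    _ = 0 := by
        refine Finset.sum_eq_zero fun i hi => ?_
        have := congrFun hc ⟨i, Finset.mem_range.1 hi⟩
        simp only [Finset.sum_apply, Pi.smul_apply, smul_eq_mul, Pi.zero_apply] at this
        rw [this, mul_zero]

theorem card_le_natDegree_of_op_eq_zero (hC : ∀ f : K, f′ = 0 → ∃ c, algebraMap C K c = f)
    {p : k[X]} (hp : p ≠ 0) {ι : Type*} [Fintype ι] {u : ι → K} (hu : LinearIndependent C u)
    (hpu : ∀ a, op p (u a) = 0) : Fintype.card ι ≤ p.natDegree := by
  have := (linearIndependent_wronskian hC hp hu hpu).fintype_card_le_finrank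
  simpa using this

/-- With a full set of solutions the Wronskian matrix is square and invertible. This is what
separates the terms `(N i) y`. -/
theorem eq_zero_of_sum_nd_mul (hC : ∀ f : K, f′ = 0 → ∃ c, algebraMap C K c = f)
    {p : k[X]} (hp : p ≠ 0) {u : Fin p.natDegree → K} (hu : LinearIndependent C u)
    (hpu : ∀ a, op p (u a) = 0) {z : ℕ → K}
    (hz : ∀ a, ∑ i ∈ Finset.range p.natDegree, nd i (u a) * z i = 0) :
    ∀ i < p.natDegree, z i = 0 := by
  have h := linearIndependent_wronskian hC hp hu hpu
  set W : Matrix (Fin p.natDegree) (Fin p.natDegree) K := fun a i => nd (i : ℕ) (u a)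
  have hW : IsUnit W := Matrix.linearIndependent_rows_iff_isUnit.1 h
  have h1 : W.mulVec (fun i => z i) = 0 := by
    funext a
    have := hz a
    rw [Finset.sum_range] at this
    exact this
  have h2 := Matrix.mulVec_injective_iff_isUnit.2 hW (h1.trans (Matrix.mulVec_zero W).symm)
  exact fun i hi => congrFun h2 ⟨i, hi⟩

end Wronskian

end SymDiv

namespace SymDiv

universe u

/-! ### Laurent series -/

section Laurent

variable {C : Type u} [Field C]

theorem coeff_laurent_deriv (f : LaurentSeries C) (n : ℤ) :
    (f′).coeff n = ((n + 1 : ℤ) : C) * f.coeff (n + 1) :=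
  laurentDeriv_coeff f n

theorem coeff_nd (i : ℕ) (f : LaurentSeries C) (n : ℤ) :
    (nd i f).coeff n = (descPochhammer C i).eval ((n + i : ℤ) : C) * f.coeff (n + i) := by
  induction i generalizing n with
  | zero => simp
  | succ i ih =>
    rw [nd_succ, coeff_laurent_deriv, ih, descPochhammer_succ_right]
    have : n + 1 + (i : ℤ) = n + ((i + 1 : ℕ) : ℤ) := by push_cast; ring
    rw [this, eval_mul]
    simp only [eval_sub, eval_X, eval_natCast]
    push_cast
    ring

theorem exists_algebraMap_eq_of_deriv_eq_zero [CharZero C] (f : LaurentSeries C) (hf : f′ = 0) :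
    ∃ c, algebraMap C (LaurentSeries C) c = f := by
  refine ⟨f.coeff 0, ?_⟩
  rw [show algebraMap C (LaurentSeries C) (f.coeff 0) = HahnSeries.C (f.coeff 0) from
    HahnSeries.algebraMap_apply]
  ext n
  by_cases hn : n = 0
  · simp [hn]
  · have h := coeff_laurent_deriv f (n - 1)
    rw [hf, HahnSeries.coeff_zero, sub_add_cancel] at h
    have h2 : f.coeff n = 0 :=
      (mul_eq_zero.1 h.symm).resolve_left (by exact_mod_cast hn)
    rw [h2, HahnSeries.C_apply, HahnSeries.coeff_single_of_ne hn]

/-- The sequence with `y n = Φ n y`, where `Φ n` sees only the terms of index less than `n`. -/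
def recSeq (Φ : ℕ → (ℕ → C) → C) : ℕ → C
  | n => Φ n (fun m => if _h : m < n then recSeq Φ m else 0)
termination_by n => n

theorem nd_ofPowerSeries (i : ℕ) (y : ℕ → C) :
    nd i (HahnSeries.ofPowerSeries ℤ C (PowerSeries.mk y)) =
      HahnSeries.ofPowerSeries ℤ C
        (PowerSeries.mk fun n => ((n + i).descFactorial i : C) * y (n + i)) := by
  ext n
  rw [coeff_nd, PowerSeries.coeff_coe, PowerSeries.coeff_coe]
  by_cases hn : n < 0
  · rw [if_pos hn]
    by_cases hn' : n + i < 0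
    · rw [if_pos hn', mul_zero]
    -- For `-i ≤ n < 0` the falling factorial of `n + i` contains the factor `0`.
    · obtain ⟨m, hm⟩ := Int.eq_ofNat_of_zero_le (not_lt.1 hn')
      rw [hm, Int.cast_natCast, descPochhammer_eval_eq_descFactorial,
        Nat.descFactorial_eq_zero_iff_lt.2 (by omega), Nat.cast_zero, zero_mul]
  · obtain ⟨m, rfl⟩ := Int.eq_ofNat_of_zero_le (not_lt.1 hn)
    rw [if_neg (by omega), if_neg (by omega), ← Nat.cast_add, Int.cast_natCast,
      descPochhammer_eval_eq_descFactorial, Int.natAbs_natCast, Int.natAbs_natCast,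
      PowerSeries.coeff_mk, PowerSeries.coeff_mk]

/-- Cauchy's existence theorem for power series solutions. -/
theorem exists_powerSeries_solution [CharZero C] (r : ℕ) (b : ℕ → PowerSeries C) (init : ℕ → C) :
    ∃ y : ℕ → C, (∀ j < r, y j = init j) ∧
      nd r (HahnSeries.ofPowerSeries ℤ C (PowerSeries.mk y)) =
        ∑ i ∈ Finset.range r, HahnSeries.ofPowerSeries ℤ C (b i) *
          nd i (HahnSeries.ofPowerSeries ℤ C (PowerSeries.mk y)) := by
  -- Comparing coefficients of `x^(m - r)` determines `y m`. The right-hand side involves only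
  -- indices at most `m - r + i < m`, and the factor of `y m` is invertible in characteristic zero.
  set Φ : ℕ → (ℕ → C) → C := fun m y => if m < r then init m else
    ((m.descFactorial r : ℕ) : C)⁻¹ * ∑ i ∈ Finset.range r,
      ∑ x ∈ Finset.HasAntidiagonal.antidiagonal (m - r), PowerSeries.coeff x.1 (b i) *
        (((x.2 + i).descFactorial i : C) * y (x.2 + i)) with hΦ
  refine ⟨recSeq Φ, fun j hj => ?_, ?_⟩
  · rw [recSeq, hΦ]
    simp [hj]
  · simp only [nd_ofPowerSeries, ← map_mul, ← map_sum]
    congr 1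
    ext n
    rw [PowerSeries.coeff_mk, map_sum]
    have h1 : (((n + r).descFactorial r : ℕ) : C) ≠ 0 := by
      rw [Nat.cast_ne_zero, Ne, Nat.descFactorial_eq_zero_iff_lt]
      omega
    rw [recSeq]
    simp only [hΦ]
    rw [if_neg (by omega), mul_inv_cancel_left₀ h1, Nat.add_sub_cancel]
    refine Finset.sum_congr rfl fun i hi => ?_
    rw [PowerSeries.coeff_mul]
    refine Finset.sum_congr rfl fun x hx => ?_
    have hx' := Finset.HasAntidiagonal.mem_antidiagonal.1 hx
    have hi' := Finset.mem_range.1 hi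
    rw [PowerSeries.coeff_mk, dif_pos (by omega)]

/-- All `lᵢ / lᵣ` are power series. -/
def IsRegular (l : (RatFunc C)[X]) : Prop :=
  ∀ i, ∃ a : PowerSeries C, algebraMap (RatFunc C) (LaurentSeries C)
    (l.coeff i / l.leadingCoeff) = HahnSeries.ofPowerSeries ℤ C a

theorem IsRegular.exists_solution [CharZero C] {l : (RatFunc C)[X]} (hl : IsRegular l)
    (h0 : l ≠ 0) (init : ℕ → C) :
    ∃ f : LaurentSeries C, op l f = 0 ∧ (∀ n < 0, f.coeff n = 0) ∧
      ∀ j < l.natDegree, f.coeff (j : ℤ) = init j := by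
  choose a ha using hl
  obtain ⟨y, hy, hy'⟩ := exists_powerSeries_solution l.natDegree (fun i => - a i) init
  refine ⟨HahnSeries.ofPowerSeries ℤ C (PowerSeries.mk y), ?_, fun n hn => ?_, fun j hj => ?_⟩
  rotate_left
  · rw [PowerSeries.coeff_coe, if_pos hn]
  · rw [PowerSeries.coeff_coe, if_neg (by omega), Int.natAbs_natCast, PowerSeries.coeff_mk, hy j hj]
  · rw [op_eq_sum_range (Nat.lt_succ_self _), Finset.sum_range_succ, hy', Finset.mul_sum,
      ← Finset.sum_add_distrib]
    refine Finset.sum_eq_zero fun i _ => ?_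
    rw [map_neg, ← ha, coeff_natDegree]
    have : algebraMap (RatFunc C) (LaurentSeries C) l.leadingCoeff ≠ 0 := by
      simpa using h0
    rw [map_div₀]
    field_simp
    ring

/-- The initial values are the unit vectors, so the `t`-th solution starts with `xᵗ`. These orders
are needed later for the indicial roots. -/
theorem IsRegular.exists_basis [CharZero C] {l : (RatFunc C)[X]} (hl : IsRegular l) (h0 : l ≠ 0) :
    ∃ f : Fin l.natDegree → LaurentSeries C, LinearIndependent C f ∧ (∀ t, op l (f t) = 0) ∧
      ∀ t, (f t).coeff ((t : ℕ) : ℤ) = 1 ∧ ∀ n : ℤ, n < (t : ℕ) → (f t).coeff n = 0 := by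
  choose f hf hneg hj using fun t : Fin l.natDegree =>
    hl.exists_solution h0 (fun j => if j = t then 1 else 0)
  refine ⟨f, ?_, hf, fun t => ⟨by simp [hj t t t.2], fun n hn => ?_⟩⟩
  · rw [Fintype.linearIndependent_iff]
    intro c hc t
    have := congrArg (fun z : LaurentSeries C => z.coeff ((t : ℕ) : ℤ)) hc
    simp only [HahnSeries.coeff_sum, HahnSeries.coeff_smul, HahnSeries.coeff_zero,
      fun s => hj s t t.2] at this
    rw [Finset.sum_eq_single t (fun s _ hs => by
      rw [if_neg (fun h => hs (Fin.ext h.symm)), smul_zero]) (by simp)] at this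
    simpa using this
  · by_cases h : n < 0
    · exact hneg t n h
    · obtain ⟨m, rfl⟩ := Int.eq_ofNat_of_zero_le (not_lt.1 h)
      have hm : m < (t : ℕ) := by exact_mod_cast hn
      rw [hj t m (hm.trans t.2), if_neg hm.ne]

end Laurent

/-! ### Translations -/

section Shift

variable {C : Type u} [Field C]

open DiffOp

theorem ratShift_algebraMap (ξ : C) (p : C[X]) :
    ratShift ξ (algebraMap C[X] (RatFunc C) p) =
      algebraMap C[X] (RatFunc C) (algEquivAevalXAddC ξ p) := by
  have h := RatFunc.map_apply_div (algEquivAevalXAddC ξ)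
    (nonZeroDivisors_le_comap_nonZeroDivisors_of_injective _ (algEquivAevalXAddC ξ).injective) p 1
  rw [map_one, map_one, map_one, div_one, div_one] at h
  exact h

theorem ratShift_ratShift_neg (ξ : C) (f : RatFunc C) : ratShift ξ (ratShift (-ξ) f) = f := by
  have hp (p : C[X]) : algEquivAevalXAddC ξ (algEquivAevalXAddC (-ξ) p) = p := by
    rw [← algEquivAevalXAddC_symm, AlgEquiv.apply_symm_apply]
  conv_lhs => rw [← RatFunc.num_div_denom f]
  rw [map_div₀, map_div₀]
  simp only [ratShift_algebraMap, hp]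
  exact RatFunc.num_div_denom f

theorem algEquivAevalXAddC_eq_comp (ξ : C) (p : C[X]) :
    algEquivAevalXAddC ξ p = p.comp (X + Polynomial.C ξ) := by
  rw [algEquivAevalXAddC_apply, aeval_def, comp]; rfl

theorem derivative_algEquivAevalXAddC (ξ : C) (p : C[X]) :
    derivative (algEquivAevalXAddC ξ p) = algEquivAevalXAddC ξ (derivative p) := by
  rw [algEquivAevalXAddC_eq_comp, algEquivAevalXAddC_eq_comp, derivative_comp]
  simp

theorem ratShift_deriv (ξ : C) (f : RatFunc C) : (ratShift ξ f)′ = ratShift ξ f′ := by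
  have hd : algEquivAevalXAddC ξ f.denom ≠ 0 :=
    (map_ne_zero_iff _ (algEquivAevalXAddC ξ).injective).2 f.denom_ne_zero
  rw [rat_deriv_eq, rat_deriv_eq]
  conv_lhs => rw [← RatFunc.num_div_denom f, map_div₀, ratShift_algebraMap, ratShift_algebraMap,
    ratDeriv_div _ _ hd]
  simp only [ratDeriv, map_div₀, map_pow, ratShift_algebraMap, derivative_algEquivAevalXAddC,
    map_sub, map_mul]

/-- The translated denominator has constant term `f.denom.eval ξ`, so it is invertible as a power
series. -/
theorem exists_powerSeries_of_eval_denom_ne_zero (ξ : C) (f : RatFunc C)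
    (hf : f.denom.eval ξ ≠ 0) :
    ∃ a : PowerSeries C, algebraMap (RatFunc C) (LaurentSeries C) (ratShift ξ f) =
      HahnSeries.ofPowerSeries ℤ C a := by
  set N := algEquivAevalXAddC ξ f.num
  set E := algEquivAevalXAddC ξ f.denom with hE
  have hmap (p : C[X]) : algebraMap (RatFunc C) (LaurentSeries C)
      (algebraMap C[X] (RatFunc C) p) = HahnSeries.ofPowerSeries ℤ C (p : PowerSeries C) := by
    rw [← IsScalarTower.algebraMap_apply, Polynomial.algebraMap_hahnSeries_apply]
  have h0 : PowerSeries.constantCoeff (E : PowerSeries C) ≠ 0 := by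
    rw [← PowerSeries.coeff_zero_eq_constantCoeff_apply, Polynomial.coeff_coe,
      coeff_zero_eq_eval_zero, hE, algEquivAevalXAddC_eq_comp, eval_comp]
    simpa using hf
  have hE0 : (E : PowerSeries C) ≠ 0 := fun h => h0 (by rw [h, map_zero])
  refine ⟨(N : PowerSeries C) * (E : PowerSeries C)⁻¹, ?_⟩
  conv_lhs => rw [← RatFunc.num_div_denom f, map_div₀, ratShift_algebraMap, ratShift_algebraMap,
    map_div₀, hmap, hmap]
  rw [div_eq_iff (by
    rw [Ne, map_eq_zero_iff _ HahnSeries.ofPowerSeries_injective]; exact hE0), ← map_mul,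
    mul_assoc, PowerSeries.inv_mul_cancel _ h0, mul_one]

theorem map_ratShift_ne_zero (ξ : C) {l : (RatFunc C)[X]} (hl : l ≠ 0) :
    l.map (ratShift ξ) ≠ 0 := (Polynomial.map_ne_zero_iff (ratShift ξ).injective).2 hl

theorem isRegular_shift {ξ : C} {L : DiffOp C} (h : IsOrdinaryPoint ξ L) :
    IsRegular (L.shift ξ).symbol := by
  intro i
  have := exists_powerSeries_of_eval_denom_ne_zero ξ _ (h i)
  rw [map_div₀] at this
  rw [shift, leadingCoeff_map, coeff_map]
  exact this

theorem exists_isOrdinaryPoint [Infinite C] (L M : DiffOp C) :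
    ∃ ξ, IsOrdinaryPoint ξ L ∧ IsOrdinaryPoint ξ M := by
  have key (L : DiffOp C) : ∃ p : C[X], p ≠ 0 ∧ ∀ ξ, p.eval ξ ≠ 0 → IsOrdinaryPoint ξ L := by
    refine ⟨∏ i ∈ Finset.range (L.ord + 1), (L.coeff i / L.coeff L.ord).denom,
      Finset.prod_ne_zero_iff.2 fun i _ => RatFunc.denom_ne_zero _, fun ξ hξ i => ?_⟩
    rw [eval_prod, Finset.prod_ne_zero_iff] at hξ
    by_cases hi : i < L.ord + 1
    · exact hξ i (Finset.mem_range.2 hi)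
    · have : L.coeff i = 0 := coeff_eq_zero_of_natDegree_lt (by unfold ord at hi; omega)
      simp [this]
  obtain ⟨p, hp, hpL⟩ := key L
  obtain ⟨q, hq, hqM⟩ := key M
  obtain ⟨ξ, hξ⟩ : ∃ ξ, (p * q).eval ξ ≠ 0 := by
    by_contra! h
    exact mul_ne_zero hp hq (Polynomial.funext fun x => by rw [h x, eval_zero])
  rw [eval_mul] at hξ
  exact ⟨ξ, hpL ξ (left_ne_zero_of_mul hξ), hqM ξ (right_ne_zero_of_mul hξ)⟩

/-- The algebra structure over `C(x)` twisted by the substitution `x ↦ x + ξ`. -/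
abbrev twistAlgebra (ξ : C) (F : Type*) [CommRing F] [Algebra (RatFunc C) F] :
    Algebra (RatFunc C) F :=
  ((algebraMap (RatFunc C) F).comp (ratShift ξ)).toAlgebra

theorem twistDifferentialAlgebra (ξ : C) (F : Type*) [CommRing F] [Algebra (RatFunc C) F]
    [Differential F] [DifferentialAlgebra (RatFunc C) F] :
    @DifferentialAlgebra (RatFunc C) F _ _ (twistAlgebra ξ F) _ _ :=
  @DifferentialAlgebra.mk _ _ _ _ (twistAlgebra ξ F) _ _ fun a => by
    change (algebraMap (RatFunc C) F (ratShift ξ a))′ = algebraMap (RatFunc C) F (ratShift ξ a′)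
    rw [deriv_algebraMap, ratShift_deriv]

/-- Trades translating an operator for changing the algebra structure. A property quantified over
all differential rings can thus be translated by applying it to a twisted ring. -/
theorem op_twist (ξ : C) {F : Type*} [CommRing F] [inst : Algebra (RatFunc C) F] [Differential F]
    (p : (RatFunc C)[X]) (f : F) :
    @op (RatFunc C) _ F _ (twistAlgebra ξ F) _ p f = op (p.map (ratShift ξ)) f := by
  induction p using Polynomial.induction_on' with
  | add p q hp hq =>
    rw [Polynomial.map_add]
    exact (@op_add _ _ _ _ (twistAlgebra ξ F) _ p q f).trans
      ((congrArg₂ (· + ·) hp hq).trans (op_add _ _ _).symm)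
  | monomial n c =>
    rw [map_monomial]
    have h := op_monomial n (ratShift ξ c) f
    exact (@op_monomial _ _ _ _ (twistAlgebra ξ F) _ n c f).trans h.symm

/-- Two operators have full solution spaces in some common differential field without new
constants. -/
theorem exists_full_field [CharZero C] {L P : DiffOp C} (hL : L.symbol ≠ 0) (hP : P.symbol ≠ 0) :
    ∃ (K : Type u) (_ : Field K) (_ : Algebra C K) (_ : Algebra (RatFunc C) K)
      (_ : Differential K) (_ : DifferentialAlgebra (RatFunc C) K),
      (∀ f : K, f′ = 0 → ∃ c, algebraMap C K c = f) ∧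
      (∃ u : Fin L.symbol.natDegree → K, LinearIndependent C u ∧ ∀ a, op L.symbol (u a) = 0) ∧
      ∃ u : Fin P.symbol.natDegree → K, LinearIndependent C u ∧ ∀ a, op P.symbol (u a) = 0 := by
  -- The field is `C((x))`, viewed as the expansions at a common ordinary point `ξ` through the
  -- twisted structure.
  obtain ⟨ξ, h1, h2⟩ := exists_isOrdinaryPoint L P
  refine ⟨LaurentSeries C, inferInstance, inferInstance, twistAlgebra ξ _, inferInstance,
    twistDifferentialAlgebra ξ _, exists_algebraMap_eq_of_deriv_eq_zero, ?_, ?_⟩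
  · obtain ⟨f, hf, hf', -⟩ := (isRegular_shift h1).exists_basis (map_ratShift_ne_zero ξ hL)
    have e : L.symbol.natDegree = (L.shift ξ).symbol.natDegree := (natDegree_map _).symm
    refine ⟨fun a => f (Fin.cast e a), hf.comp _ (Fin.cast_injective e), fun a => ?_⟩
    exact (op_twist ξ L.symbol _).trans (hf' _)
  · obtain ⟨f, hf, hf', -⟩ := (isRegular_shift h2).exists_basis (map_ratShift_ne_zero ξ hP)
    have e : P.symbol.natDegree = (P.shift ξ).symbol.natDegree := (natDegree_map _).symm
    refine ⟨fun a => f (Fin.cast e a), hf.comp _ (Fin.cast_injective e), fun a => ?_⟩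
    exact (op_twist ξ P.symbol _).trans (hf' _)

end Shift

end SymDiv

namespace SymDiv

universe u

variable {C : Type u} [Field C]

namespace DiffOp

theorem apply_eq_op {F : Type*} [CommRing F] [Algebra (RatFunc C) F] [Differential F]
    (L : DiffOp C) (f : F) : L.apply f = op L.symbol f := rfl

theorem symbol_mul (A P : DiffOp C) : (A * P).symbol = opMul A.symbol P.symbol := rfl

theorem symbol_ne_zero {L : DiffOp C} : L.symbol ≠ 0 ↔ L ≠ 0 :=
  not_congr ⟨fun h => DiffOp.ext h, fun h => by rw [h]; rfl⟩

theorem ne_zero_of_ord_pos {L : DiffOp C} (h : 0 < L.ord) : L ≠ 0 := by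
  rintro rfl
  exact h.ne' natDegree_zero

theorem isRightFactor_iff {P M : DiffOp C} :
    IsRightFactor P M ↔ ∃ b, M.symbol = opMul b P.symbol :=
  ⟨fun ⟨A, h⟩ => ⟨A.symbol, by rw [h, symbol_mul]⟩, fun ⟨b, h⟩ => ⟨⟨b⟩, DiffOp.ext h⟩⟩

/-! ### Primitive operators -/

theorem isPrimitive_one : (1 : DiffOp C).IsPrimitive :=
  ⟨1, by rw [Polynomial.map_one]; rfl, Polynomial.isPrimitive_one, by
    rw [leadingCoeff_one]; exact monic_one⟩

theorem IsPrimitive.ne_zero {Q : DiffOp C} (h : Q.IsPrimitive) : Q ≠ 0 := by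
  obtain ⟨q, hq, hp, -⟩ := h
  rw [← symbol_ne_zero, ← hq]
  exact (Polynomial.map_ne_zero_iff (RatFunc.algebraMap_injective C)).2 hp.ne_zero

/-- Clear denominators, divide by the content, and divide by the constant `e` that spoils monicity;
`e` is a unit, so primitivity survives. -/
theorem exists_isPrimitive {L : DiffOp C} (hL : L ≠ 0) :
    ∃ (P : DiffOp C) (c : RatFunc C), P.IsPrimitive ∧ c ≠ 0 ∧
      P.symbol = Polynomial.C c * L.symbol := by
  classical
  let _ : NormalizedGCDMonoid C[X] := UniqueFactorizationMonoid.toNormalizedGCDMonoid _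
  obtain ⟨b, hb, hbL⟩ := IsLocalization.integerNormalization_spec (nonZeroDivisors C[X]) L.symbol
  set q := IsLocalization.integerNormalization (nonZeroDivisors C[X]) L.symbol
  have hb0 : algebraMap C[X] (RatFunc C) b ≠ 0 :=
    RatFunc.algebraMap_ne_zero (nonZeroDivisors.ne_zero hb)
  have hbL' : q.map (algebraMap C[X] (RatFunc C)) =
      Polynomial.C (algebraMap C[X] (RatFunc C) b) * L.symbol := by
    rw [hbL, ← smul_eq_C_mul, algebraMap_smul]
  have hq0 : q ≠ 0 := by
    intro h
    rw [h, Polynomial.map_zero] at hbL'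
    exact mul_ne_zero (Polynomial.C_ne_zero.2 hb0) (symbol_ne_zero.2 hL) hbL'.symm
  have hcont : q.content ≠ 0 := content_eq_zero_iff.not.2 hq0
  have hcont' := RatFunc.algebraMap_ne_zero hcont
  set e := q.primPart.leadingCoeff.leadingCoeff with he
  have he0 : e ≠ 0 := by
    rw [he, leadingCoeff_ne_zero, leadingCoeff_ne_zero]
    exact q.isPrimitive_primPart.ne_zero
  have hunit : Polynomial.C (Polynomial.C e) * Polynomial.C (Polynomial.C e⁻¹) =
      (1 : C[X][X]) := by
    rw [← Polynomial.C_mul, ← Polynomial.C_mul, mul_inv_cancel₀ he0]; simp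
  set p := Polynomial.C (Polynomial.C e⁻¹) * q.primPart with hp
  refine ⟨⟨p.map (algebraMap C[X] (RatFunc C))⟩,
    algebraMap C[X] (RatFunc C) (Polynomial.C e⁻¹) *
      ((algebraMap C[X] (RatFunc C) q.content)⁻¹ * algebraMap C[X] (RatFunc C) b),
    ⟨p, rfl, isPrimitive_of_dvd q.isPrimitive_primPart
      ⟨Polynomial.C (Polynomial.C e), ?_⟩, ?_⟩, ?_, ?_⟩
  · rw [hp]; linear_combination (-q.primPart) * hunit
  · rw [hp, leadingCoeff_mul, leadingCoeff_C, Monic, leadingCoeff_mul, leadingCoeff_C, ← he,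
      inv_mul_cancel₀ he0]
  · refine mul_ne_zero (RatFunc.algebraMap_ne_zero ?_) (mul_ne_zero (inv_ne_zero hcont') hb0)
    simpa using he0
  · have h1 := congrArg (Polynomial.map (algebraMap C[X] (RatFunc C))) q.eq_C_content_mul_primPart
    rw [hbL', Polynomial.map_mul, map_C] at h1
    simp only [hp, Polynomial.map_mul, map_C, mul_assoc, Polynomial.C_mul]
    rw [h1, ← mul_assoc (Polynomial.C _⁻¹), ← Polynomial.C_mul, inv_mul_cancel₀ hcont',
      Polynomial.C_1, one_mul]

/-- By Gauss's lemma proportional primitive polynomials divide each other over `C[x]`. They differ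
by a unit, which the monic leading coefficients force to be `1`. -/
theorem IsPrimitive.eq_of_symbol_eq {P Q : DiffOp C} (hP : P.IsPrimitive) (hQ : Q.IsPrimitive)
    {c : RatFunc C} (h : P.symbol = Polynomial.C c * Q.symbol) : P = Q := by
  classical
  let _ : NormalizedGCDMonoid C[X] := UniqueFactorizationMonoid.toNormalizedGCDMonoid _
  have hc : c ≠ 0 := by
    rintro rfl
    exact symbol_ne_zero.2 hP.ne_zero (by rw [h]; simp)
  obtain ⟨p, hp, hpp, hpm⟩ := hP
  obtain ⟨q, hq, hqp, hqm⟩ := hQ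
  rw [← hp, ← hq] at h
  have h1 : q ∣ p := (hqp.dvd_iff_fraction_map_dvd_fraction_map (RatFunc C)).2
    ⟨Polynomial.C c, by rw [h, mul_comm]⟩
  have h2 : p ∣ q := (hpp.dvd_iff_fraction_map_dvd_fraction_map (RatFunc C)).2
    ⟨Polynomial.C c⁻¹, by
      rw [h, mul_comm, ← mul_assoc, ← Polynomial.C_mul, inv_mul_cancel₀ hc]; simp⟩
  obtain ⟨v, hv⟩ := associated_of_dvd_dvd h1 h2
  obtain ⟨w, hw, hwv⟩ := Polynomial.isUnit_iff.1 v.isUnit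
  rw [← hwv] at hv
  have hw1 : q.leadingCoeff = p.leadingCoeff := by
    refine eq_of_monic_of_associated hqm hpm ⟨hw.unit, ?_⟩
    rw [← hv, leadingCoeff_mul, leadingCoeff_C, IsUnit.unit_spec]
  have hw2 : w = 1 := by
    have : q.leadingCoeff * w = q.leadingCoeff * 1 := by
      rw [mul_one]
      conv_rhs => rw [hw1, ← hv, leadingCoeff_mul, leadingCoeff_C]
    exact mul_left_cancel₀ hqm.ne_zero this
  rw [hw2, Polynomial.C_1, mul_one] at hv
  exact DiffOp.ext (by rw [← hp, ← hq, hv])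

theorem IsPrimitive.eq_of_opMul {P Q : DiffOp C} (hP : P.IsPrimitive) (hQ : Q.IsPrimitive)
    {b : (RatFunc C)[X]} (h : P.symbol = opMul b Q.symbol) (hord : P.ord ≤ Q.ord) : P = Q := by
  have hb : b ≠ 0 := by
    rintro rfl
    exact symbol_ne_zero.2 hP.ne_zero (by rw [h, opMul_zero_left])
  have h1 := natDegree_add_le_of_opMul hb (symbol_ne_zero.2 hQ.ne_zero)
  rw [← h] at h1
  unfold ord at hord
  rw [eq_C_of_natDegree_eq_zero (p := b) (by omega), opMul_C] at h
  exact hP.eq_of_symbol_eq hQ h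

/-! ### Symmetric products -/

theorem AnnihilatesProducts.opMul_right {L₁ L₂ P M : DiffOp C} (hP : AnnihilatesProducts L₁ L₂ P)
    {b : (RatFunc C)[X]} (h : M.symbol = opMul b P.symbol) : AnnihilatesProducts L₁ L₂ M := by
  intro F _ _ _ _ f₁ f₂ h₁ h₂
  have := hP F f₁ f₂ h₁ h₂
  rw [apply_eq_op] at this ⊢
  rw [h, op_opMul, this, op_zero_right]

/-- All derivatives of `f₁ f₂` are combinations of the `r q` products `f₁⁽ⁱ⁾ f₂⁽ˡ⁾`, with
coefficients independent of the ring. So the first `r q + 1` of them satisfy a universal linear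
relation. -/
theorem exists_annihilatesProducts {L₁ L₂ : DiffOp C} (h₁ : L₁ ≠ 0) (h₂ : L₂ ≠ 0) :
    ∃ N : DiffOp C, N ≠ 0 ∧ AnnihilatesProducts L₁ L₂ N := by
  rw [← symbol_ne_zero] at h₁ h₂
  set r := L₁.symbol.natDegree
  set q := L₂.symbol.natDegree
  choose N _ hN using fun j : ℕ => exists_op_mul_eq.{u} L₁.symbol h₁ (X ^ j)
  choose b R hbR hR using fun j i : ℕ => exists_eq_opMul_add (N j i) h₂
  set v : Fin (r * q + 1) → Fin r → Fin q → RatFunc C := fun j i l => (R j i).coeff l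
  have hv : ¬ LinearIndependent (RatFunc C) v := by
    intro h
    have := h.fintype_card_le_finrank
    simp [Module.finrank_pi_fintype] at this
  obtain ⟨g, hg, j₀, hj₀⟩ := Fintype.not_linearIndependent_iff.1 hv
  refine ⟨⟨∑ j : Fin (r * q + 1), Polynomial.C (g j) * X ^ (j : ℕ)⟩, ?_, ?_⟩
  · rw [← symbol_ne_zero]
    intro h
    have := congrArg (fun p => p.coeff j₀) h
    simp only [finsetSum_coeff, coeff_C_mul_X_pow, coeff_zero] at this
    rw [Finset.sum_eq_single j₀ (fun s _ hs => if_neg fun h => hs (Fin.ext h.symm)) (by simp)]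
      at this
    exact hj₀ (by simpa using this)
  · intro F _ _ _ _ f₁ f₂ hf₁ hf₂
    rw [apply_eq_op] at hf₁ hf₂ ⊢
    have key (j : ℕ) : op (X ^ j : (RatFunc C)[X]) (f₁ * f₂) =
        ∑ i ∈ Finset.range r, ∑ l ∈ Finset.range q,
          algebraMap (RatFunc C) F ((R j i).coeff l) * (nd i f₁ * nd l f₂) := by
      rw [hN j F f₁ f₂ hf₁]
      refine Finset.sum_congr rfl fun i _ => ?_
      rw [hbR j i, op_add, op_opMul, hf₂, op_zero_right, zero_add,
        op_eq_sum_range_of_degree_lt ((hR j i).trans_le degree_le_natDegree), Finset.mul_sum]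
      exact Finset.sum_congr rfl fun l _ => by ring
    simp only [op_sum, op_C_mul, key, Finset.mul_sum]
    rw [Finset.sum_comm]
    refine Finset.sum_eq_zero fun i hi => ?_
    rw [Finset.sum_comm]
    refine Finset.sum_eq_zero fun l hl => ?_
    simp only [← mul_assoc, ← map_mul, ← Finset.sum_mul, ← map_sum]
    have := congrFun (congrFun hg ⟨i, Finset.mem_range.1 hi⟩) ⟨l, Finset.mem_range.1 hl⟩
    simp only [Finset.sum_apply, Pi.smul_apply, smul_eq_mul, Pi.zero_apply, v] at this
    rw [this, map_zero, zero_mul, zero_mul]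

theorem exists_isSymProd {L₁ L₂ : DiffOp C} (h₁ : L₁ ≠ 0) (h₂ : L₂ ≠ 0) :
    ∃ P, IsSymProd L₁ L₂ P := by
  classical
  have hex : ∃ n, ∃ N : DiffOp C, N ≠ 0 ∧ AnnihilatesProducts L₁ L₂ N ∧ N.ord = n := by
    obtain ⟨N, h, h'⟩ := exists_annihilatesProducts h₁ h₂
    exact ⟨_, N, h, h', rfl⟩
  obtain ⟨N, hN0, hN, hNord⟩ := Nat.find_spec hex
  obtain ⟨P, c, hP, hc, hPN⟩ := exists_isPrimitive hN0
  refine ⟨P, hP, hN.opMul_right (b := Polynomial.C c) (by rw [hPN, opMul_C]), fun N' h h' => ?_⟩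
  have : P.ord = N.ord := by rw [ord, hPN, natDegree_C_mul hc]; rfl
  rw [this, hNord]
  exact Nat.find_min' hex ⟨N', h, h', rfl⟩

theorem isSymProd_symProd {L₁ L₂ : DiffOp C} (h₁ : L₁ ≠ 0) (h₂ : L₂ ≠ 0) :
    IsSymProd L₁ L₂ (symProd L₁ L₂) := by
  have h := exists_isSymProd h₁ h₂
  rw [symProd, dif_pos h]
  exact h.choose_spec

/-- The remainder of `M` modulo the symmetric product again annihilates all products, and has lower
order unless it is zero. From here on only annihilation has to be checked. -/
theorem isRightFactor_symProd_iff {L₁ L₂ M : DiffOp C} (h₁ : L₁ ≠ 0) (h₂ : L₂ ≠ 0) :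
    IsRightFactor (symProd L₁ L₂) M ↔ AnnihilatesProducts L₁ L₂ M := by
  obtain ⟨hP, hA, hmin⟩ := isSymProd_symProd h₁ h₂
  rw [isRightFactor_iff]
  refine ⟨fun ⟨b, h⟩ => hA.opMul_right h, fun h => ?_⟩
  obtain ⟨b, r, hbr, hr⟩ := exists_eq_opMul_add M.symbol (symbol_ne_zero.2 hP.ne_zero)
  refine ⟨b, ?_⟩
  suffices hr0 : r = 0 by rw [hbr, hr0, add_zero]
  by_contra hr0
  have h2 := hmin ⟨r⟩ (symbol_ne_zero.1 hr0) (by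
    intro F _ _ _ _ f₁ f₂ hf₁ hf₂
    have e₁ := h F f₁ f₂ hf₁ hf₂
    have e₂ := hA F f₁ f₂ hf₁ hf₂
    rw [apply_eq_op] at e₁ e₂ ⊢
    rw [hbr, op_add, op_opMul, e₂, op_zero_right, zero_add] at e₁
    exact e₁)
  exact absurd h2 (natDegree_lt_natDegree hr0 hr).not_ge

theorem symPow_ne_zero {L : DiffOp C} (hL : L ≠ 0) (s : ℕ) : symPow L s ≠ 0 := by
  induction s with
  | zero => exact symbol_ne_zero.1 (show (X : (RatFunc C)[X]) ≠ 0 from X_ne_zero)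
  | succ s ih => exact (isSymProd_symProd ih hL).1.ne_zero

theorem symPow_apply_prod {L : DiffOp C} (hL : L ≠ 0) (s : ℕ) {F : Type u} [CommRing F]
    [Algebra (RatFunc C) F] [Differential F] [DifferentialAlgebra (RatFunc C) F] (f : ℕ → F)
    (hf : ∀ i < s, L.apply (f i) = 0) : (symPow L s).apply (∏ i ∈ Finset.range s, f i) = 0 := by
  induction s with
  | zero =>
    rw [apply_eq_op]
    change op (X : (RatFunc C)[X]) _ = 0
    rw [← pow_one X, op_X_pow, nd_succ]
    simp
  | succ s ih =>
    rw [Finset.prod_range_succ]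
    exact (isSymProd_symProd (symPow_ne_zero hL s) hL).2.1 F _ _
      (ih fun i hi => hf i (by omega)) (hf s (by omega))

/-! ### Existence of the quasi-symmetric quotient -/

/-- Division of an operator by one with a full solution space on which it vanishes. -/
theorem exists_opMul_of_full {k K : Type*} [Field k] [Differential k] [Field K] [Algebra C K]
    [Algebra k K] [Differential K] [DifferentialAlgebra k K]
    (hC : ∀ f : K, f′ = 0 → ∃ c, algebraMap C K c = f) {p : k[X]} (hp : p ≠ 0)
    {ι : Type*} [Fintype ι] (hι : p.natDegree ≤ Fintype.card ι)
    {u : ι → K} (hu : LinearIndependent C u) (hpu : ∀ a, op p (u a) = 0) (m : k[X])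
    (hm : ∀ a, op m (u a) = 0) : ∃ b, m = opMul b p := by
  obtain ⟨b, r, hbr, hr⟩ := exists_eq_opMul_add m hp
  refine ⟨b, ?_⟩
  suffices hr0 : r = 0 by rw [hbr, hr0, add_zero]
  by_contra hr0
  have h1 := card_le_natDegree_of_op_eq_zero hC hr0 hu fun a => by
    have := hm a
    rwa [hbr, op_add, op_opMul, hpu, op_zero_right, zero_add] at this
  have := natDegree_lt_natDegree hr0 hr
  omega

/-- `Q` is a greatest common right divisor of the operators `N i` in
`M · (f y) = ∑ f⁽ⁱ⁾ (N i · y)`. -/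
structure IsColonOperator (M L Q : DiffOp C) (N B : ℕ → (RatFunc C)[X]) : Prop where
  primitive : Q.IsPrimitive
  natDegree_le : ∀ i, (N i).natDegree ≤ M.ord
  op_mul : ∀ (F : Type u) [CommRing F] [Algebra (RatFunc C) F] [Differential F]
    [DifferentialAlgebra (RatFunc C) F] (f y : F), op L.symbol f = 0 →
      op M.symbol (f * y) = ∑ i ∈ Finset.range L.ord, nd i f * op (N i) y
  eq_opMul : ∀ i < L.ord, N i = opMul (B i) Q.symbol
  op_eq_zero : ∀ (F : Type u) [CommRing F] [Algebra (RatFunc C) F] [Differential F]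
    [DifferentialAlgebra (RatFunc C) F] (y : F), (∀ i < L.ord, op (N i) y = 0) →
      op Q.symbol y = 0

/-- `Q` has least order among the nonzero operators that kill the common solutions of the `N i` in
every differential ring. The remainder of `N i` modulo `Q` kills them too, so it is zero. -/
theorem exists_isColonOperator [CharZero C] {M L : DiffOp C} (hM : M ≠ 0) (hL : 0 < L.ord) :
    ∃ Q N B, IsColonOperator M L Q N B := by
  classical
  have hL0 := symbol_ne_zero.2 (ne_zero_of_ord_pos hL)
  have hM0 := symbol_ne_zero.2 hM
  obtain ⟨N, hN, hNF⟩ := exists_op_mul_eq.{u} L.symbol hL0 M.symbol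
  set I : DiffOp C → Prop := fun n => ∀ (F : Type u) [CommRing F] [Algebra (RatFunc C) F]
    [Differential F] [DifferentialAlgebra (RatFunc C) F] (y : F),
    (∀ i < L.ord, op (N i) y = 0) → op n.symbol y = 0 with hI
  have hex : ∃ d, ∃ n : DiffOp C, n ≠ 0 ∧ I n ∧ n.ord = d := by
    -- If all `N i` were zero, `M` would kill every multiple of a nonzero solution of `L`, hence the
    -- whole field, which contains the `M.ord + 1` independent solutions of `D ^ (M.ord + 1)`.
    obtain ⟨i, hi, hNi⟩ : ∃ i < L.ord, N i ≠ 0 := by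
      by_contra! h
      obtain ⟨K, _, _, _, _, _, hC, ⟨v, hv, hLv⟩, w, hw, -⟩ := exists_full_field hL0
        (P := ⟨X ^ (M.ord + 1)⟩) (pow_ne_zero _ X_ne_zero)
      have hv0 := hv.ne_zero ⟨0, hL⟩
      have hle := card_le_natDegree_of_op_eq_zero hC hM0 hw fun a => by
        have := hNF K _ (w a / v ⟨0, hL⟩) (hLv ⟨0, hL⟩)
        rw [mul_div_cancel₀ _ hv0] at this
        rw [this]
        exact Finset.sum_eq_zero fun i hi => by rw [h i (Finset.mem_range.1 hi)]; simp
      simp [ord] at hle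
    exact ⟨_, ⟨N i⟩, symbol_ne_zero.1 hNi, fun F _ _ _ _ y hy => hy i hi, rfl⟩
  obtain ⟨n, hn0, hnI, hnord⟩ := Nat.find_spec hex
  obtain ⟨Q, c, hQ, hc, hQn⟩ := exists_isPrimitive hn0
  have hQI : I Q := fun F _ _ _ _ y hy => by rw [hQn, op_C_mul, hnI F y hy, mul_zero]
  have hdiv : ∀ i, ∃ b, i < L.ord → N i = opMul b Q.symbol := by
    intro i
    by_cases hi : i < L.ord
    · obtain ⟨b, r, hbr, hr⟩ := exists_eq_opMul_add (N i) (symbol_ne_zero.2 hQ.ne_zero)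
      refine ⟨b, fun _ => ?_⟩
      suffices hr0 : r = 0 by rw [hbr, hr0, add_zero]
      by_contra hr0
      have h1 := Nat.find_min' hex ⟨⟨r⟩, symbol_ne_zero.1 hr0, fun F _ _ _ _ y hy => by
        have := hy i hi
        rwa [hbr, op_add, op_opMul, hQI F y hy, op_zero_right, zero_add] at this, rfl⟩
      have h2 := natDegree_lt_natDegree hr0 hr
      rw [hQn, natDegree_C_mul hc] at h2
      unfold ord at hnord h1
      dsimp only at h1
      omega
    · exact ⟨0, fun h => absurd h hi⟩
  choose B hB using hdiv
  exact ⟨Q, N, B, hQ, hN, hNF, hB, hQI⟩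

namespace IsColonOperator

variable {M L Q : DiffOp C} {N B : ℕ → (RatFunc C)[X]}

theorem annihilatesProducts (h : IsColonOperator M L Q N B) : AnnihilatesProducts L Q M := by
  intro F _ _ _ _ f y hf hy
  rw [apply_eq_op] at hf hy ⊢
  rw [h.op_mul F f y hf]
  refine Finset.sum_eq_zero fun i hi => ?_
  rw [h.eq_opMul i (Finset.mem_range.1 hi), op_opMul, hy, op_zero_right, mul_zero]

theorem op_eq_zero_iff (h : IsColonOperator M L Q N B) {K : Type u} [Field K] [Algebra C K]
    [Algebra (RatFunc C) K] [Differential K] [DifferentialAlgebra (RatFunc C) K]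
    (hC : ∀ f : K, f′ = 0 → ∃ c, algebraMap C K c = f) (hL : L ≠ 0)
    {u : Fin L.symbol.natDegree → K} (hu : LinearIndependent C u)
    (hLu : ∀ a, op L.symbol (u a) = 0) (y : K) :
    op Q.symbol y = 0 ↔ ∀ f, op L.symbol f = 0 → op M.symbol (f * y) = 0 := by
  refine ⟨fun hy f hf => h.annihilatesProducts K f y hf hy, fun hy => h.op_eq_zero K y ?_⟩
  exact eq_zero_of_sum_nd_mul hC (symbol_ne_zero.2 hL) hu hLu (z := fun i => op (N i) y)
    fun a => by rw [← hy _ (hLu a), h.op_mul K _ _ (hLu a)]; rfl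

/-- `P` has a full solution space in a suitable field, and `op_eq_zero_iff` shows that `Q` vanishes
on it. Both maximality and uniqueness of `Q` follow. -/
theorem exists_opMul [CharZero C] (h : IsColonOperator M L Q N B) (hL : L ≠ 0) {P : DiffOp C}
    (hP : P ≠ 0) (hLP : AnnihilatesProducts L P M) : ∃ b, Q.symbol = opMul b P.symbol := by
  obtain ⟨K, _, _, _, _, _, hC, ⟨v, hv, hLv⟩, w, hw, hPw⟩ :=
    exists_full_field (symbol_ne_zero.2 hL) (symbol_ne_zero.2 hP)
  exact exists_opMul_of_full hC (symbol_ne_zero.2 hP) (by simp) hw hPw _ fun a =>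
    (h.op_eq_zero_iff hC hL hv hLv _).2 fun f hf => hLP K f _ hf (hPw a)

theorem isQuasiSymmetricQuotient [CharZero C] (h : IsColonOperator M L Q N B) (hL : L ≠ 0) :
    IsQuasiSymmetricQuotient M L Q := by
  refine ⟨h.primitive, (isRightFactor_symProd_iff hL h.primitive.ne_zero).2 h.annihilatesProducts,
    fun P hP hPM => ?_⟩
  obtain ⟨b, hb⟩ := h.exists_opMul hL hP ((isRightFactor_symProd_iff hL hP).1 hPM)
  have hb0 : b ≠ 0 := by
    rintro rfl
    exact symbol_ne_zero.2 h.primitive.ne_zero (by rw [hb, opMul_zero_left])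
  have := natDegree_add_le_of_opMul hb0 (symbol_ne_zero.2 hP)
  rw [← hb] at this
  exact le_trans (Nat.le_add_right _ _) this

theorem eq_of_isQuasiSymmetricQuotient [CharZero C] (h : IsColonOperator M L Q N B) (hL : L ≠ 0)
    {P : DiffOp C} (hP : IsQuasiSymmetricQuotient M L P) : P = Q := by
  have hP0 := hP.1.ne_zero
  obtain ⟨b, hb⟩ := h.exists_opMul hL hP0 ((isRightFactor_symProd_iff hL hP0).1 hP.2.1)
  have hQ := h.isQuasiSymmetricQuotient hL
  exact (hQ.1.eq_of_opMul hP.1 hb (hP.2.2 Q hQ.1.ne_zero hQ.2.1)).symm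

end IsColonOperator

end DiffOp

end SymDiv

namespace SymDiv

universe u

variable {C : Type u} [Field C]

/-! ### Solution spaces in `C((x))` -/

theorem op_smul {k : Type*} [Field k] [Algebra k (LaurentSeries C)] (p : k[X]) (c : C)
    (f : LaurentSeries C) : op p (c • f) = c • op p f := by
  have h : (algebraMap C (LaurentSeries C) c)′ = 0 := by
    rw [Algebra.algebraMap_eq_smul_one, DiffOp.deriv_smul_const]
    simp
  rw [Algebra.smul_def, Algebra.smul_def, op_const_mul _ h]

/-- The `C`-linear map defined by an operator. -/
def opLin {k : Type*} [Field k] [Algebra k (LaurentSeries C)] (p : k[X]) :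
    LaurentSeries C →ₗ[C] LaurentSeries C where
  toFun := op p
  map_add' := op_add_right p
  map_smul' := op_smul p

/-- The coefficient field is left general because the bound is applied both over `C(x)` and over
`C((x))`. -/
theorem finite_of_op_eq_zero [CharZero C] {k : Type*} [Field k] [Differential k]
    [Algebra k (LaurentSeries C)] [DifferentialAlgebra k (LaurentSeries C)] {p : k[X]} (hp : p ≠ 0)
    (W : Submodule C (LaurentSeries C)) (hW : ∀ w ∈ W, op p w = 0) :
    Module.Finite C W ∧ Module.finrank C W ≤ p.natDegree := by
  have h : Module.rank C W ≤ p.natDegree := rank_le fun s hs => by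
    have := card_le_natDegree_of_op_eq_zero exists_algebraMap_eq_of_deriv_eq_zero hp
      (hs.map' W.subtype W.ker_subtype) fun a => hW _ (a : W).2
    simpa using this
  exact ⟨Module.rank_lt_aleph0_iff.1 (h.trans_lt Cardinal.natCast_lt_aleph0),
    Module.finrank_le_of_rank_le h⟩

/-- The monomials `1, x, …` up to exponent `p.natDegree` are too many independent solutions. -/
theorem exists_op_ne_zero [CharZero C] {k : Type*} [Field k] [Differential k]
    [Algebra k (LaurentSeries C)] [DifferentialAlgebra k (LaurentSeries C)] {p : k[X]}
    (hp : p ≠ 0) : ∃ y : LaurentSeries C, op p y ≠ 0 := by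
  by_contra! h
  have hli : LinearIndependent C fun j : Fin (p.natDegree + 1) =>
      (HahnSeries.single ((j : ℕ) : ℤ) (1 : C) : LaurentSeries C) := by
    rw [Fintype.linearIndependent_iff]
    intro c hc j
    have := congrArg (fun z : LaurentSeries C => z.coeff ((j : ℕ) : ℤ)) hc
    simp only [HahnSeries.coeff_sum, HahnSeries.coeff_smul, HahnSeries.coeff_zero] at this
    rw [Finset.sum_eq_single j (fun s _ hs => by
      rw [HahnSeries.coeff_single_of_ne (fun h => hs (Fin.ext (by exact_mod_cast h.symm))),
        smul_zero]) (by simp)] at this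
    simpa using this
  have := card_le_natDegree_of_op_eq_zero exists_algebraMap_eq_of_deriv_eq_zero hp hli
    fun a => h _
  simp at this

namespace DiffOp

/-! ### Dimension of the colon space -/

section Dimension

variable [CharZero C] {M L Q : DiffOp C} {N B : ℕ → (RatFunc C)[X]}

theorem IsColonOperator.mem_colonSpace (h : IsColonOperator M L Q N B) (hL : L ≠ 0)
    (hLr : IsRegular L.symbol) (y : LaurentSeries C) :
    y ∈ colonSpace M L ↔ op Q.symbol y = 0 := by
  obtain ⟨f, hf, hLf, -⟩ := hLr.exists_basis (symbol_ne_zero.2 hL)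
  rw [h.op_eq_zero_iff exists_algebraMap_eq_of_deriv_eq_zero hL hf hLf, colonSpace,
    Submodule.mem_div_iff_forall_mul_mem]
  refine forall_congr' fun g => ?_
  rw [mul_comm]
  exact Iff.rfl

theorem IsColonOperator.finite_colonSpace (h : IsColonOperator M L Q N B) (hL : L ≠ 0)
    (hLr : IsRegular L.symbol) :
    Module.Finite C (colonSpace M L) ∧ Module.finrank C (colonSpace M L) ≤ Q.ord :=
  finite_of_op_eq_zero (symbol_ne_zero.2 h.primitive.ne_zero) _
    fun w hw => (h.mem_colonSpace hL hLr w).1 hw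

theorem IsColonOperator.finrank_colonSpace (h : IsColonOperator M L Q N B) (hL : 0 < L.ord)
    (hM : M ≠ 0) (hLr : IsRegular L.symbol) (hMr : IsRegular M.symbol) :
    Module.finrank C (colonSpace M L) = Q.ord := by
  have hL0 := ne_zero_of_ord_pos hL
  obtain ⟨hfin, hle⟩ := h.finite_colonSpace hL0 hLr
  refine le_antisymm hle ?_
  obtain ⟨f, hf, hLf, -⟩ := hLr.exists_basis (symbol_ne_zero.2 hL0)
  obtain ⟨g, hg, hMg, -⟩ := hMr.exists_basis (symbol_ne_zero.2 hM)
  set f₀ := f ⟨0, hL⟩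
  have hf₀ : f₀ ≠ 0 := hf.ne_zero _
  have hLf₀ : op L.symbol f₀ = 0 := hLf _
  have hw : LinearIndependent C fun a => f₀⁻¹ * g a := by
    refine hg.map' (LinearMap.mulLeft C f₀⁻¹) (LinearMap.ker_eq_bot.2 fun a b hab => ?_)
    exact mul_left_cancel₀ (inv_ne_zero hf₀) hab
  set V := Submodule.span C (Set.range fun a => f₀⁻¹ * g a)
  have hVM (v) (hv : v ∈ V) : op M.symbol (f₀ * v) = 0 := by
    induction hv using Submodule.span_induction with
    | mem x hx =>
      obtain ⟨a, rfl⟩ := hx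
      dsimp only
      rw [mul_inv_cancel_left₀ hf₀, hMg]
    | zero => simp
    | add x y _ _ hx hy => rw [mul_add, op_add_right, hx, hy, add_zero]
    | smul c x _ hx => rw [mul_smul_comm, op_smul, hx, smul_zero]
  have hVfin : Module.Finite C V := Module.Finite.span_of_finite C (Set.finite_range _)
  have hVrank : Module.finrank C V = M.ord := by
    rw [finrank_span_eq_card hw, Fintype.card_fin]; rfl
  -- Substituting `N i = (B i) Q` into the expansion of `M (f₀ y)` leaves `b` as the left cofactor
  -- of `Q`.
  set b : (LaurentSeries C)[X] := ∑ i ∈ Finset.range L.ord,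
    Polynomial.C (nd i f₀) * (B i).map (algebraMap (RatFunc C) (LaurentSeries C)) with hb
  have hbM (y : LaurentSeries C) : op b (op Q.symbol y) = op M.symbol (f₀ * y) := by
    rw [h.op_mul _ _ _ hLf₀, hb, op_sum]
    refine Finset.sum_congr rfl fun i hi => ?_
    rw [op_C_mul, op_map, h.eq_opMul i (Finset.mem_range.1 hi), op_opMul]
    rfl
  have hb0 : b ≠ 0 := by
    intro hb0
    obtain ⟨y, hy⟩ := exists_op_ne_zero (C := C) (symbol_ne_zero.2 hM)
    have := hbM (f₀⁻¹ * y)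
    rw [hb0, op_zero, mul_inv_cancel_left₀ hf₀] at this
    exact hy this.symm
  have hdeg (i) (hi : i < L.ord) (hBi : B i ≠ 0) : (B i).natDegree + Q.ord ≤ M.ord := by
    have h1 := natDegree_add_le_of_opMul hBi (symbol_ne_zero.2 h.primitive.ne_zero)
    rw [← h.eq_opMul i hi] at h1
    rw [add_comm]
    exact h1.trans (h.natDegree_le i)
  have hQM : Q.ord ≤ M.ord := by
    obtain ⟨i, hi, hBi⟩ : ∃ i < L.ord, B i ≠ 0 := by
      by_contra! hB
      exact hb0 (Finset.sum_eq_zero fun i hi => by rw [hB i (Finset.mem_range.1 hi)]; simp)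
    exact (Nat.le_add_left _ _).trans (hdeg i hi hBi)
  have hbdeg : b.natDegree ≤ M.ord - Q.ord := by
    refine natDegree_sum_le_of_forall_le _ _ fun i hi => (natDegree_C_mul_le _ _).trans ?_
    rw [natDegree_map]
    by_cases hBi : B i = 0
    · simp [hBi]
    · have := hdeg i (Finset.mem_range.1 hi) hBi
      omega
  set ψ : V →ₗ[C] LaurentSeries C := (opLin Q.symbol).domRestrict V
  -- `Q` maps `V = f₀⁻¹ V(M)` into the solutions of `b`, so its image has dimension at most `M.ord -
  -- Q.ord`; rank-nullity bounds the kernel from below.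
  have h1 := (finite_of_op_eq_zero hb0 (LinearMap.range ψ) (by
    rintro _ ⟨v, rfl⟩
    exact (hbM v).trans (hVM v v.2))).2
  have h2 := LinearMap.finrank_range_add_finrank_ker ψ
  have h3 : Module.finrank C (LinearMap.ker ψ) ≤ Module.finrank C (colonSpace M L) := by
    refine LinearMap.finrank_le_finrank_of_injective
      (f := (V.subtype.comp (LinearMap.ker ψ).subtype).codRestrict (colonSpace M L) fun v =>
        (h.mem_colonSpace hL0 hLr _).2 v.2) fun v w hvw => ?_
    have h4 : ((v : V) : LaurentSeries C) = ((w : V) : LaurentSeries C) :=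
      congrArg (fun z : colonSpace M L => (z : LaurentSeries C)) hvw
    exact Subtype.ext (Subtype.ext h4)
  omega

end Dimension

/-! ### Indicial polynomials -/

theorem IsPrimitive.coeff_eq {Q : DiffOp C} (hQ : Q.IsPrimitive) (i : ℕ) :
    Q.coeff i = algebraMap C[X] (RatFunc C) (Q.coeff i).num := by
  obtain ⟨q, hq, -⟩ := hQ
  have : Q.coeff i = algebraMap C[X] (RatFunc C) (q.coeff i) := by rw [coeff, ← hq, coeff_map]
  rw [this, RatFunc.num_algebraMap]

theorem coeff_algebraMap_mul (p : C[X]) {D : ℕ} (hp : p.natDegree < D) (g : LaurentSeries C)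
    (n : ℤ) :
    (algebraMap (RatFunc C) (LaurentSeries C) (algebraMap C[X] (RatFunc C) p) * g).coeff n =
      ∑ j ∈ Finset.range D, p.coeff j * g.coeff (n - j) := by
  have hm (j : ℕ) (a : C) : algebraMap C[X] (LaurentSeries C) (monomial j a) =
      HahnSeries.single (j : ℤ) a := by
    rw [Polynomial.algebraMap_hahnSeries_apply, Polynomial.coe_monomial]
    ext m
    rw [PowerSeries.coeff_coe, HahnSeries.coeff_single]
    split_ifs with h1 h2 h2
    · omega
    · rfl
    · rw [h2, Int.natAbs_natCast, PowerSeries.coeff_monomial_same]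
    · rw [PowerSeries.coeff_monomial, if_neg (by omega)]
  rw [← IsScalarTower.algebraMap_apply]
  conv_lhs => rw [p.as_sum_range' D hp, map_sum, Finset.sum_mul]
  rw [HahnSeries.coeff_sum]
  exact Finset.sum_congr rfl fun j _ => by rw [hm, HahnSeries.coeff_single_mul]

theorem IsPrimitive.coeff_op {Q : DiffOp C} (hQ : Q.IsPrimitive) {δ : ℕ} (hδ : Q.ord ≤ δ)
    (D : ℕ → ℕ) (hD : ∀ i ≤ δ, (Q.coeff i).num.natDegree < D i) (f : LaurentSeries C) (n : ℤ) :
    (op Q.symbol f).coeff n = ∑ i ∈ Finset.range (δ + 1), ∑ j ∈ Finset.range (D i),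
      (Q.coeff i).num.coeff j * (nd i f).coeff (n - j) := by
  rw [op_eq_sum_range (Nat.lt_succ_of_le hδ), HahnSeries.coeff_sum]
  refine Finset.sum_congr rfl fun i hi => ?_
  change (algebraMap (RatFunc C) (LaurentSeries C) (Q.coeff i) * nd i f).coeff n = _
  rw [hQ.coeff_eq i, coeff_algebraMap_mul _ (hD i (Nat.lt_succ_iff.1 (Finset.mem_range.1 hi))),
    RatFunc.num_algebraMap]

theorem monomialAction_eq_zero {N : DiffOp C} {e : ℤ} (he : e < -(N.ord : ℤ)) :
    N.monomialAction e = 0 := by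
  refine Finset.sum_eq_zero fun i hi => if_neg ?_
  have := Finset.mem_range.1 hi
  omega

theorem bddBelow_monomialAction (N : DiffOp C) : BddBelow {e | N.monomialAction e ≠ 0} :=
  ⟨-(N.ord : ℤ), fun _ he => not_lt.1 fun h => he (monomialAction_eq_zero h)⟩

theorem exists_monomialAction_ne_zero {N : DiffOp C} (hN : N ≠ 0) :
    ∃ e, N.monomialAction e ≠ 0 := by
  set p := (N.coeff N.ord).num
  have hp : p ≠ 0 := RatFunc.num_ne_zero (leadingCoeff_ne_zero.2 (symbol_ne_zero.2 hN))
  -- This shift picks the leading coefficient of `p`. Only the falling factorial of degree `N.ord`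
  -- contributes to the coefficient of `s ^ N.ord`, so nothing cancels.
  refine ⟨p.natDegree - N.ord, fun h => ?_⟩
  have h1 := congrArg (fun q => q.coeff N.ord) h
  simp only [monomialAction, finsetSum_coeff, coeff_zero] at h1
  rw [Finset.sum_range_succ, Finset.sum_eq_zero, zero_add, if_pos (by omega), coeff_C_mul] at h1
  · have h2 : (descPochhammer C N.ord).coeff N.ord = 1 := by
      have := monic_descPochhammer C N.ord
      rwa [Monic, leadingCoeff, descPochhammer_natDegree] at this
    have h3 : ((N.ord : ℤ) + (p.natDegree - N.ord)).toNat = p.natDegree := by omega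
    rw [h2, h3, mul_one] at h1
    exact hp (leadingCoeff_eq_zero.1 h1)
  · intro i hi
    split_ifs
    · rw [coeff_C_mul, coeff_eq_zero_of_natDegree_lt (p := descPochhammer C i), mul_zero]
      rw [descPochhammer_natDegree]
      exact Finset.mem_range.1 hi
    · simp

/-- The infimum over `ℤ` is attained because the set is nonempty and bounded below. -/
theorem indicialPoly_ne_zero {N : DiffOp C} (hN : N ≠ 0) : N.indicialPoly ≠ 0 :=
  Int.csInf_mem (exists_monomialAction_ne_zero hN) N.bddBelow_monomialAction

theorem coeff_op_eq_sum_monomialAction {N : DiffOp C} (hN : N.IsPrimitive) {D : ℕ}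
    (hD : ∀ i ≤ N.ord, (N.coeff i).num.natDegree ≤ D) (f : LaurentSeries C) (n : ℤ) :
    (op N.symbol f).coeff n = ∑ e ∈ Finset.Icc (-(N.ord : ℤ)) D,
      (N.monomialAction e).eval ((n - e : ℤ) : C) * f.coeff (n - e) := by
  -- With `D + i + 1` terms, `e = j - i` runs exactly through `-i, …, D`, so the upper end is the
  -- same for every `i`.
  rw [hN.coeff_op le_rfl (fun i => D + i + 1) fun i hi => by have := hD i hi; omega]
  simp only [monomialAction, eval_finsetSum, Finset.sum_mul]
  rw [Finset.sum_comm]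
  refine Finset.sum_congr rfl fun i hi => ?_
  have hi' := Finset.mem_range.1 hi
  rw [← Finset.sum_filter_of_ne (p := fun e : ℤ => 0 ≤ (i : ℤ) + e) fun e _ he => by
    by_contra h
    rw [if_neg h, eval_zero, zero_mul] at he
    exact he rfl]
  refine Finset.sum_nbij' (fun j => (j : ℤ) - i) (fun e => ((i : ℤ) + e).toNat) ?_ ?_ ?_ ?_ ?_
  · intro j hj
    have := Finset.mem_range.1 hj
    simp only [Finset.mem_filter, Finset.mem_Icc]
    omega
  · intro e he
    simp only [Finset.mem_filter, Finset.mem_Icc] at he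
    simp only [Finset.mem_range]
    omega
  · intro j _; omega
  · intro e he
    simp only [Finset.mem_filter, Finset.mem_Icc] at he
    omega
  · intro j _
    have e1 : (i : ℤ) + (j - i) = j := by ring
    have e2 : n - ((j : ℤ) - i) = n - j + i := by ring
    rw [coeff_nd, e1, if_pos (Int.natCast_nonneg j), e2, Int.toNat_natCast, eval_mul, eval_C]
    ring

/-- The coefficient of `x ^ (v + σ)` in `N f` is the indicial polynomial at `v` times the lowest
coefficient of `f`: smaller shifts act as zero, and larger ones meet coefficients below the order.
-/
theorem mem_indicialRoots {N : DiffOp C} (hN : N.IsPrimitive) {f : LaurentSeries C} (hf : f ≠ 0)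
    (hNf : op N.symbol f = 0) {v : ℕ} (hv : f.order = v) : v ∈ N.indicialRoots := by
  set σ := sInf {e | N.monomialAction e ≠ 0} with hσ
  have hσmem : N.monomialAction σ ≠ 0 := indicialPoly_ne_zero hN.ne_zero
  -- Adding `σ.toNat` ensures `σ ≤ D`, so that `σ` lies in the summation range.
  set D := (∑ i ∈ Finset.range (N.ord + 1), (N.coeff i).num.natDegree) + σ.toNat with hDdef
  have hD : ∀ i ≤ N.ord, (N.coeff i).num.natDegree ≤ D := fun i hi =>
    (Finset.single_le_sum (f := fun i => (N.coeff i).num.natDegree) (fun _ _ => Nat.zero_le _)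
      (Finset.mem_range.2 (Nat.lt_succ_of_le hi))).trans (Nat.le_add_right _ _)
  have h1 := coeff_op_eq_sum_monomialAction hN hD f (v + σ)
  rw [hNf, HahnSeries.coeff_zero, Finset.sum_eq_single σ] at h1
  · have h2 : f.coeff (v : ℤ) ≠ 0 := by
      rw [← hv, Ne, HahnSeries.coeff_order_eq_zero]; exact hf
    rw [add_sub_cancel_right] at h1
    have h3 := (mul_eq_zero.1 h1.symm).resolve_right h2
    rw [Int.cast_natCast] at h3
    exact h3
  · intro e _ he
    rcases lt_or_gt_of_ne he with he | he
    · have := notMem_of_lt_csInf he N.bddBelow_monomialAction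
      rw [Set.mem_ofPred_eq, not_not] at this
      rw [this, eval_zero, zero_mul]
    · rw [HahnSeries.coeff_eq_zero_of_lt_order (by rw [hv]; omega), mul_zero]
  · intro h
    refine absurd (Finset.mem_Icc.2 ⟨not_lt.1 fun h => hσmem (monomialAction_eq_zero h), ?_⟩) h
    rw [hDdef]
    push_cast
    have := Int.self_le_toNat σ
    have : (0 : ℤ) ≤ ∑ i ∈ Finset.range (N.ord + 1), ((N.coeff i).num.natDegree : ℤ) :=
      Finset.sum_nonneg fun _ _ => by positivity
    omega

theorem exists_isGreatest_indicialRoots [CharZero C] {N : DiffOp C} (hN : N ≠ 0) {v : ℕ}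
    (hv : v ∈ N.indicialRoots) : ∃ m, IsGreatest N.indicialRoots m := by
  classical
  have hfin : N.indicialRoots.Finite := by
    refine Set.Finite.of_finite_image (f := fun k : ℕ => (k : C)) ?_ Nat.cast_injective.injOn
    refine (N.indicialPoly.roots.toFinset.finite_toSet).subset ?_
    rintro _ ⟨k, hk, rfl⟩
    simp only [Finset.mem_coe, Multiset.mem_toFinset, mem_roots', IsRoot]
    exact ⟨indicialPoly_ne_zero hN, hk⟩
  exact ⟨_, Nat.sSup_mem ⟨v, hv⟩ hfin.bddAbove, fun k hk => le_csSup hfin.bddAbove hk⟩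

theorem exists_solution_order_eq [CharZero C] {L : DiffOp C} (hL : L ≠ 0)
    (hLr : IsRegular L.symbol) {t : ℕ} (ht : t < L.ord) :
    ∃ f : LaurentSeries C, f ≠ 0 ∧ op L.symbol f = 0 ∧ f.order = t := by
  obtain ⟨f, hf, hLf, hft⟩ := hLr.exists_basis (symbol_ne_zero.2 hL)
  have hne := hf.ne_zero ⟨t, ht⟩
  refine ⟨f ⟨t, ht⟩, hne, hLf _, le_antisymm ?_ ?_⟩
  · exact HahnSeries.order_le_of_coeff_ne_zero (by rw [(hft ⟨t, ht⟩).1]; exact one_ne_zero)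
  · by_contra h
    exact hne (HahnSeries.coeff_order_eq_zero.1 ((hft ⟨t, ht⟩).2 _ (not_le.1 h)))

/-- A solution of `M` of order `0` times solutions of `L` of orders `1, …, r - 1` is a solution of
the symmetric product, of order `r (r - 1) / 2`. -/
theorem mem_indicialRoots_symProd [CharZero C] {M L : DiffOp C} (hM : 0 < M.ord) (hL : 0 < L.ord)
    (hLr : IsRegular L.symbol) (hMr : IsRegular M.symbol) :
    L.ord * (L.ord - 1) / 2 ∈ (symProd M (symPow L (L.ord - 1))).indicialRoots := by
  have hL0 := ne_zero_of_ord_pos hL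
  have hM0 := ne_zero_of_ord_pos hM
  have hsp := isSymProd_symProd hM0 (symPow_ne_zero hL0 (L.ord - 1))
  have hex (i : ℕ) : ∃ f : LaurentSeries C, i < L.ord - 1 →
      f ≠ 0 ∧ op L.symbol f = 0 ∧ f.order = ((i + 1 : ℕ) : ℤ) := by
    by_cases hi : i < L.ord - 1
    · obtain ⟨f, hf⟩ := exists_solution_order_eq hL0 hLr (t := i + 1) (by omega)
      exact ⟨f, fun _ => hf⟩
    · exact ⟨0, fun h => absurd h hi⟩
  choose g hg using hex
  obtain ⟨f, hf0, hf, hford⟩ := exists_solution_order_eq hM0 hMr hM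
  have hprod (s : ℕ) (hs : s ≤ L.ord - 1) : ∏ i ∈ Finset.range s, g i ≠ 0 ∧
      (∏ i ∈ Finset.range s, g i).order = ((∑ i ∈ Finset.range s, (i + 1) : ℕ) : ℤ) := by
    induction s with
    | zero => simp
    | succ s ih =>
      obtain ⟨h1, h2⟩ := ih (by omega)
      obtain ⟨h3, -, h4⟩ := hg s (by omega)
      rw [Finset.prod_range_succ, Finset.sum_range_succ]
      exact ⟨mul_ne_zero h1 h3, by rw [HahnSeries.order_mul h1 h3, h2, h4]; push_cast; rfl⟩
  obtain ⟨h1, h2⟩ := hprod _ le_rfl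
  have hsum : ∑ i ∈ Finset.range (L.ord - 1), (i + 1) = L.ord * (L.ord - 1) / 2 := by
    rw [← Finset.sum_range_id]
    obtain ⟨r, hr⟩ : ∃ r, L.ord = r + 1 := ⟨L.ord - 1, by omega⟩
    rw [hr, Nat.add_sub_cancel, Finset.sum_range_succ' (fun i => i) r, add_zero]
  refine mem_indicialRoots hsp.1 (f := f * ∏ i ∈ Finset.range (L.ord - 1), g i)
    (mul_ne_zero hf0 h1) ?_ ?_
  · exact hsp.2.1 _ _ _ hf (symPow_apply_prod hL0 _ g fun i hi => (hg i hi).2.1)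
  · rw [HahnSeries.order_mul hf0 h1, hford, h2, hsum]; simp

end DiffOp

end SymDiv

namespace SymDiv

universe u

variable {C : Type u} [Field C]

open DiffOp

/-! ### The local algorithm -/

/-- The coefficient of `xᵐ` uses coefficients of `f` of index at most `m + δ < k`, which truncation
keeps. -/
theorem coeff_op_truncate {Q : DiffOp C} (hQ : Q.IsPrimitive) {δ : ℕ} (hδ : Q.ord ≤ δ) {k m : ℤ}
    (hm : m < k - δ) (f : LaurentSeries C) :
    (op Q.symbol (truncate k f)).coeff m = (op Q.symbol f).coeff m := by
  rw [hQ.coeff_op hδ (fun i => (Q.coeff i).num.natDegree + 1) (fun i _ => Nat.lt_succ_self _),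
    hQ.coeff_op hδ (fun i => (Q.coeff i).num.natDegree + 1) (fun i _ => Nat.lt_succ_self _)]
  refine Finset.sum_congr rfl fun i hi => Finset.sum_congr rfl fun j _ => ?_
  have := Finset.mem_range.1 hi
  rw [coeff_nd, coeff_nd, truncate, HahnSeries.coeff_truncLT_of_lt (by omega)]

/-- For large precision, approximate annihilators of bounded degree are annihilators. -/
theorem exists_precision_bound (W : Submodule C (LaurentSeries C)) (δ d : ℕ) :
    ∃ n : ℕ, ∀ Q : DiffOp C, Q.IsPrimitive → Q.ord ≤ δ →
      (∀ i ≤ δ, (Q.coeff i).num.natDegree ≤ d) →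
      (∀ y ∈ W, ∀ m < (n : ℤ), (op Q.symbol y).coeff m = 0) → ∀ y ∈ W, op Q.symbol y = 0 := by
  -- `S n` collects the coefficient vectors of operators that map `W` into `O(xⁿ)`. This decreasing
  -- chain in a finite-dimensional space becomes constant, and a vector in all `S n` annihilates `W`
  -- exactly.
  set S : ℕ → Submodule C (Fin (δ + 1) → Fin (d + 1) → C) := fun n =>
    { carrier := {v | ∀ y ∈ W, ∀ m < (n : ℤ),
        ∑ i : Fin (δ + 1), ∑ j : Fin (d + 1), v i j * (nd (i : ℕ) y).coeff (m - (j : ℕ)) = 0}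
      zero_mem' := by intro y _ m _; simp
      add_mem' := by
        intro v w hv hw y hy m hm
        simp only [Pi.add_apply, add_mul, Finset.sum_add_distrib]
        rw [hv y hy m hm, hw y hy m hm, add_zero]
      smul_mem' := by
        intro c v hv y hy m hm
        simp only [Pi.smul_apply, smul_eq_mul, mul_assoc, ← Finset.mul_sum]
        rw [hv y hy m hm, mul_zero] } with hS
  have hanti : Antitone S := fun a b hab v hv y hy m hm =>
    hv y hy m (hm.trans_le (by exact_mod_cast hab))
  obtain ⟨n, hn⟩ := IsArtinian.monotone_stabilizes
    (⟨fun n => OrderDual.toDual (S n), fun a b hab => hanti hab⟩ :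
      ℕ →o (Submodule C (Fin (δ + 1) → Fin (d + 1) → C))ᵒᵈ)
  have hn' : ∀ m, n ≤ m → S n = S m := hn
  refine ⟨n, fun Q hQ hδ hd hQW y hy => ?_⟩
  have hcoeff (y : LaurentSeries C) (m : ℤ) : (op Q.symbol y).coeff m =
      ∑ i : Fin (δ + 1), ∑ j : Fin (d + 1),
        (Q.coeff i).num.coeff j * (nd (i : ℕ) y).coeff (m - (j : ℕ)) := by
    rw [hQ.coeff_op hδ (fun _ => d + 1) fun i hi => Nat.lt_succ_of_le (hd i hi), Finset.sum_range]
    exact Finset.sum_congr rfl fun i _ => Finset.sum_range _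
  set v : Fin (δ + 1) → Fin (d + 1) → C := fun i j => (Q.coeff i).num.coeff j
  have hv : v ∈ S n := fun y hy m hm => by rw [← hQW y hy m hm, hcoeff]
  ext m
  rw [HahnSeries.coeff_zero, hcoeff]
  have hv' : v ∈ S (max n (m.toNat + 1)) := hn' _ (le_max_left _ _) ▸ hv
  exact hv' y hy m (by push_cast; have := Int.self_le_toNat m; omega)

theorem not_localStep_done (out : Option (DiffOp C)) (t : LocalState C) :
    ¬ LocalStep M L (.done out) t := by
  intro h
  cases h

section Local

variable [CharZero C] {M L Q : DiffOp C} {N B : ℕ → (RatFunc C)[X]}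

theorem exists_isColonSpaceBasis (h : IsColonOperator M L Q N B) (hL : L ≠ 0)
    (hLr : IsRegular L.symbol) (k : ℤ) {δ : ℕ} (hδ : Module.finrank C (colonSpace M L) = δ) :
    ∃ f : Fin δ → LaurentSeries C, IsColonSpaceBasis M L k f := by
  have := (h.finite_colonSpace hL hLr).1
  exact ⟨_, Module.finBasisOfFinrankEq C _ hδ, fun _ => rfl⟩

theorem isApproximantAnnihilator_colonOperator (h : IsColonOperator M L Q N B) (hL : L ≠ 0)
    (hLr : IsRegular L.symbol) {δ d₀ : ℕ} (hδ : Q.ord = δ) (hd₀ : IsQuotientDegreeBound M L δ d₀)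
    {k : ℤ} (hk : ((δ : ℤ) + 1) * (d₀ + 1) + δ ≤ k) {f : Fin δ → LaurentSeries C}
    (hf : IsColonSpaceBasis M L k f) :
    IsApproximantAnnihilator f (degreeBoundAt δ d₀ k) k Q := by
  obtain ⟨b, hb⟩ := hf
  refine ⟨h.primitive, hδ.le, fun i _ => ?_, fun j m hm => ?_⟩
  -- The threshold gives `(k - δ) / (δ + 1) ≥ d₀ + 1`, so the degree bound in force is `d₀`.
  · have h1 : (d₀ : ℤ) ≤ (k - δ) / (δ + 1) := by
      rw [Int.le_ediv_iff_mul_le (by positivity)]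
      nlinarith
    rw [degreeBoundAt, min_eq_left h1]
    exact_mod_cast hd₀ Q (h.isQuasiSymmetricQuotient hL) hδ i
  · rw [hb, apply_eq_op, coeff_op_truncate h.primitive hδ.le hm,
      (h.mem_colonSpace hL hLr _).1 (b j).2, HahnSeries.coeff_zero]

theorem exists_acceptance_bound (h : IsColonOperator M L Q N B) (hL : L ≠ 0)
    (hLr : IsRegular L.symbol) {δ d₀ : ℕ} (hδ : Q.ord = δ)
    (hd₀ : IsQuotientDegreeBound M L δ d₀) :
    ∃ T : ℤ, ∀ k, T ≤ k → ∀ (f : Fin δ → LaurentSeries C) (a : Option (DiffOp C)),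
      IsColonSpaceBasis M L k f → ApproximantAnnihilatorReturns f (degreeBoundAt δ d₀ k) k a →
      a = some Q := by
  obtain ⟨n, hn⟩ := exists_precision_bound (colonSpace M L) δ d₀
  -- The first bound makes `Q` itself a candidate, which excludes `none`. The second makes `k - δ`
  -- large enough for `exists_precision_bound`.
  refine ⟨max (((δ : ℤ) + 1) * (d₀ + 1) + δ) (n + δ), fun k hk f a hf ha => ?_⟩
  cases a with
  | none =>
    exact absurd (isApproximantAnnihilator_colonOperator h hL hLr hδ hd₀
      ((le_max_left _ _).trans hk) hf) (ha Q)
  | some P =>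
    obtain ⟨hP, hPδ, hPd, hPf⟩ := ha
    obtain ⟨b, hb⟩ := hf
    have hnk : (n : ℤ) ≤ k - δ := by have := (le_max_right _ _).trans hk; omega
    have hPW := hn P hP hPδ (fun i hi => by
      have := (hPd i hi).trans (min_le_left _ _)
      exact_mod_cast this) fun y hy m hm => by
        have hbj (j : Fin δ) : (op P.symbol (b j : LaurentSeries C)).coeff m = 0 := by
          rw [← coeff_op_truncate hP hPδ (hm.trans_le hnk), ← hb]
          exact hPf j m (hm.trans_le hnk)
        have hy' : y = ∑ j, b.repr ⟨y, hy⟩ j • (b j : LaurentSeries C) := by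
          have := congrArg (colonSpace M L).subtype (b.sum_repr ⟨y, hy⟩)
          rw [map_sum] at this
          exact this.symm
        have hlin : op P.symbol y = ∑ j, b.repr ⟨y, hy⟩ j • op P.symbol (b j : LaurentSeries C) := by
          conv_lhs => rw [hy']
          exact (map_sum (opLin P.symbol) _ _).trans
            (Finset.sum_congr rfl fun j _ => op_smul _ _ _)
        rw [hlin, HahnSeries.coeff_sum]
        exact Finset.sum_eq_zero fun j _ => by rw [HahnSeries.coeff_smul, hbj, smul_zero]
    -- `P` vanishes on the colon space, a full solution space of `Q`, so it is a right multiple of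
    -- `Q`; as its order is at most `δ` and both are primitive, it equals `Q`.
    obtain ⟨q, hq⟩ := exists_opMul_of_full (C := C) (K := LaurentSeries C)
      exists_algebraMap_eq_of_deriv_eq_zero (symbol_ne_zero.2 h.primitive.ne_zero) (ι := Fin δ)
      (by rw [Fintype.card_fin]; exact hδ.le)
      (b.linearIndependent.map' (colonSpace M L).subtype (colonSpace M L).ker_subtype)
      (fun j => (h.mem_colonSpace hL hLr _).1 (b j).2) P.symbol fun j => hPW _ (b j).2
    rw [hP.eq_of_opMul h.primitive hq (hPδ.trans hδ.ge)]

/-- The invariant of the local algorithm. -/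
def LocalInvariant (M L Q : DiffOp C) : LocalState C → Prop
  | .start => True
  | .loop δ d₀ k => Module.finrank C (colonSpace M L) = δ ∧ IsQuotientDegreeBound M L δ d₀ ∧ 0 < k
  | .done out => out = some Q

/-- A candidate that passes the test and has order `Q.ord` is of maximal order, so uniqueness
applies. -/
theorem eq_colonOperator_of_accepts (h : IsColonOperator M L Q N B) (hL : L ≠ 0) {P : DiffOp C}
    (hP : P.IsPrimitive) (hPM : Accepts M L Q.ord P) : P = Q := by
  refine h.eq_of_isQuasiSymmetricQuotient hL ⟨hP, hPM.2, fun P' hP' h' => ?_⟩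
  rw [hPM.1]
  exact (h.isQuasiSymmetricQuotient hL).2.2 P' hP' h'

theorem accepts_colonOperator (h : IsColonOperator M L Q N B) (hL : L ≠ 0) :
    Accepts M L Q.ord Q := ⟨rfl, (h.isQuasiSymmetricQuotient hL).2.1⟩

theorem LocalInvariant.step (h : IsColonOperator M L Q N B) (hL : 0 < L.ord) (hM : 0 < M.ord)
    (hLr : IsRegular L.symbol) (hMr : IsRegular M.symbol) {s t : LocalState C}
    (hs : LocalInvariant M L Q s) (hst : LocalStep M L s t) : LocalInvariant M L Q t := by
  have hL0 := ne_zero_of_ord_pos hL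
  have hrank := h.finrank_colonSpace hL (ne_zero_of_ord_pos hM) hLr hMr
  cases hst with
  | zeroDim h0 =>
    rw [hrank] at h0
    have : Q.symbol = Polynomial.C (Q.symbol.coeff 0) * (1 : DiffOp C).symbol := by
      change _ = _ * 1
      rw [mul_one]
      exact eq_C_of_natDegree_eq_zero h0
    exact congrArg some (h.primitive.eq_of_symbol_eq isPrimitive_one this).symm
  | init m d₀ _ hm hd₀ =>
    refine ⟨rfl, hd₀, ?_⟩
    -- The subtracted number is itself an indicial root, so `m` is at least as large and the
    -- precision starts at `1` or more.
    have := hm.2 (mem_indicialRoots_symProd hM hL hLr hMr)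
    omega
  | giveUp δ d₀ k f a hf ha hg =>
    obtain ⟨rfl, hk⟩ := hg
    obtain ⟨hδ, hd₀, -⟩ := hs
    exact absurd (isApproximantAnnihilator_colonOperator h hL0 hLr (hrank.symm.trans hδ) hd₀ hk hf)
      (ha Q)
  | accept δ d₀ k f P hf hP hacc =>
    obtain ⟨hδ, -⟩ := hs
    rw [← hδ, hrank] at hacc
    exact congrArg some (eq_colonOperator_of_accepts h hL0 hP.1 hacc)
  | double δ d₀ k f a _ _ _ _ =>
    obtain ⟨hδ, hd₀, hk⟩ := hs
    exact ⟨hδ, hd₀, by omega⟩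

theorem LocalInvariant.progress (h : IsColonOperator M L Q N B) (hL : 0 < L.ord) (hM : 0 < M.ord)
    (hLr : IsRegular L.symbol) (hMr : IsRegular M.symbol) {s : LocalState C}
    (hs : LocalInvariant M L Q s) : s = .done (some Q) ∨ ∃ t, LocalStep M L s t := by
  have hL0 := ne_zero_of_ord_pos hL
  have hM0 := ne_zero_of_ord_pos hM
  cases s with
  | start =>
    refine Or.inr ?_
    rcases Nat.eq_zero_or_pos (Module.finrank C (colonSpace M L)) with h0 | h0
    · exact ⟨_, .zeroDim h0⟩
    · obtain ⟨m, hm⟩ := exists_isGreatest_indicialRoots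
        (isSymProd_symProd hM0 (symPow_ne_zero hL0 _)).1.ne_zero
        (mem_indicialRoots_symProd hM hL hLr hMr)
      -- The sum of the degrees of the coefficients of `Q` is an admissible `d₀`, since `Q` is the
      -- only quotient.
      refine ⟨_, .init m (∑ i ∈ Finset.range (Q.ord + 1), (Q.coeff i).num.natDegree) h0 hm ?_⟩
      intro P hP _ i
      rw [h.eq_of_isQuasiSymmetricQuotient hL0 hP]
      by_cases hi : i < Q.ord + 1
      · exact Finset.single_le_sum (f := fun i => (Q.coeff i).num.natDegree)
          (fun _ _ => Nat.zero_le _) (Finset.mem_range.2 hi)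
      · have : Q.coeff i = 0 := coeff_eq_zero_of_natDegree_lt (by unfold ord at hi; omega)
        simp [this]
  | loop δ d₀ k =>
    refine Or.inr ?_
    obtain ⟨f, hf⟩ := exists_isColonSpaceBasis h hL0 hLr k hs.1
    obtain ⟨a, ha⟩ : ∃ a, ApproximantAnnihilatorReturns f (degreeBoundAt δ d₀ k) k a := by
      by_cases hex : ∃ P, IsApproximantAnnihilator f (degreeBoundAt δ d₀ k) k P
      · exact ⟨some hex.choose, hex.choose_spec⟩
      · exact ⟨none, not_exists.1 hex⟩
    by_cases hg : GivesUp δ d₀ k a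
    · exact ⟨_, .giveUp δ d₀ k f a hf ha hg⟩
    by_cases hacc : ∃ P, a = some P ∧ Accepts M L δ P
    · obtain ⟨P, rfl, hP⟩ := hacc
      exact ⟨_, .accept δ d₀ k f P hf ha hP⟩
    · exact ⟨_, .double δ d₀ k f a hf ha hg fun P hP hP' => hacc ⟨P, hP, hP'⟩⟩
  | done out => exact Or.inl (by rw [show out = some Q from hs])

/-- Only doubling stays in the loop. As `k` is positive, `T - k` drops; once `k ≥ T` the returned
candidate is `Q`, which is accepted, so doubling is excluded. -/
theorem LocalInvariant.acc (h : IsColonOperator M L Q N B) (hL : 0 < L.ord) (hM : 0 < M.ord)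
    (hLr : IsRegular L.symbol) (hMr : IsRegular M.symbol) {s : LocalState C}
    (hs : LocalInvariant M L Q s) : Acc (fun t s => LocalStep M L s t) s := by
  have hL0 := ne_zero_of_ord_pos hL
  have hrank := h.finrank_colonSpace hL (ne_zero_of_ord_pos hM) hLr hMr
  have hdone (out) : Acc (fun t s => LocalStep M L s t) (.done out) :=
    ⟨_, fun t ht => absurd ht (not_localStep_done out t)⟩
  have hloop (δ d₀ : ℕ) (k : ℤ) (hs : LocalInvariant M L Q (.loop δ d₀ k)) :
      Acc (fun t s => LocalStep M L s t) (.loop δ d₀ k) := by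
    obtain ⟨hδ, hd₀, hk⟩ := hs
    have hQδ := hrank.symm.trans hδ
    obtain ⟨T, hT⟩ := exists_acceptance_bound h hL0 hLr hQδ hd₀
    induction hj : (T - k).toNat using Nat.strong_induction_on generalizing k with
    | _ j ih =>
      refine ⟨_, fun t ht => ?_⟩
      cases ht with
      | giveUp => exact hdone _
      | accept => exact hdone _
      | double _ _ _ f a hf ha _ hacc =>
        have hkT : k < T := by
          by_contra hkT
          exact hacc Q (hT k (not_lt.1 hkT) f a hf ha) (hQδ ▸ accepts_colonOperator h hL0)
        exact ih _ (by omega) (2 * k) (by omega) rfl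
  cases s with
  | start =>
    refine ⟨_, fun t ht => ?_⟩
    have ht' := hs.step h hL hM hLr hMr ht
    cases ht with
    | zeroDim => exact hdone _
    | init => exact hloop _ _ _ ht'
  | loop δ d₀ k => exact hloop δ d₀ k hs
  | done out => exact hdone out

end Local

end SymDiv

namespace SymDiv

universe u

variable {C : Type u} [Field C]

namespace DiffOp

/-! ### Translation of operators -/

theorem ord_shift (ξ : C) (L : DiffOp C) : (L.shift ξ).ord = L.ord := natDegree_map _

theorem shift_ne_zero (ξ : C) {L : DiffOp C} (hL : L ≠ 0) : L.shift ξ ≠ 0 :=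
  symbol_ne_zero.1 (map_ratShift_ne_zero ξ (symbol_ne_zero.2 hL))

theorem shift_shift_neg (ξ : C) (L : DiffOp C) : (L.shift (-ξ)).shift ξ = L := by
  refine DiffOp.ext ?_
  ext i
  simp only [shift, coeff_map, ratShift_ratShift_neg]

theorem shift_neg_shift (ξ : C) (L : DiffOp C) : (L.shift ξ).shift (-ξ) = L := by
  have := shift_shift_neg (-ξ) L
  rwa [neg_neg] at this

theorem IsPrimitive.shift {Q : DiffOp C} (hQ : Q.IsPrimitive) (ξ : C) :
    (Q.shift ξ).IsPrimitive := by
  obtain ⟨q, hq, hp, hm⟩ := hQ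
  set φ : C[X] →+* C[X] := ((algEquivAevalXAddC ξ : C[X] ≃ₐ[C] C[X]) : C[X] →+* C[X])
  set ψ : C[X] →+* C[X] := ((algEquivAevalXAddC (-ξ) : C[X] ≃ₐ[C] C[X]) : C[X] →+* C[X])
  have hψφ (p : C[X]) : ψ (φ p) = p := by
    change algEquivAevalXAddC (-ξ) (algEquivAevalXAddC ξ p) = p
    rw [← algEquivAevalXAddC_symm, AlgEquiv.symm_apply_apply]
  have hφψ (p : C[X]) : φ (ψ p) = p := by
    change algEquivAevalXAddC ξ (algEquivAevalXAddC (-ξ) p) = p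
    rw [← algEquivAevalXAddC_symm, AlgEquiv.apply_symm_apply]
  refine ⟨q.map φ, ?_, fun r hr => ?_, ?_⟩
  · rw [DiffOp.shift, ← hq, Polynomial.map_map, Polynomial.map_map]
    congr 1
    exact RingHom.ext fun p => (ratShift_algebraMap ξ p).symm
  · have h1 := map_dvd (mapRingHom ψ) hr
    rw [coe_mapRingHom, map_C, Polynomial.map_map, show ψ.comp φ = RingHom.id _ from
      RingHom.ext hψφ, Polynomial.map_id] at h1
    have h2 := (hp _ h1).map φ
    rwa [hφψ] at h2
  · rw [leadingCoeff_map_of_injective (f := φ) (algEquivAevalXAddC ξ).injective]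
    change (algEquivAevalXAddC ξ q.leadingCoeff).Monic
    rw [algEquivAevalXAddC_eq_comp]
    exact hm.comp_X_add_C ξ

/-- The hypothesis is applied to the same ring `F` with its twisted structure over `C(x)`. -/
theorem AnnihilatesProducts.shift {L₁ L₂ N : DiffOp C} (h : AnnihilatesProducts L₁ L₂ N) (ξ : C) :
    AnnihilatesProducts (L₁.shift ξ) (L₂.shift ξ) (N.shift ξ) := by
  intro F _ _ _ _ f₁ f₂ h₁ h₂
  exact (op_twist ξ N.symbol _).symm.trans
    (@h F _ (twistAlgebra ξ F) _ (twistDifferentialAlgebra ξ F) f₁ f₂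
      ((op_twist ξ L₁.symbol _).trans h₁) ((op_twist ξ L₂.symbol _).trans h₂))

theorem IsRightFactor.shift_symProd {L P M : DiffOp C} (hL : L ≠ 0) (hP : P ≠ 0)
    (h : IsRightFactor (symProd L P) M) (ξ : C) :
    IsRightFactor (symProd (L.shift ξ) (P.shift ξ)) (M.shift ξ) :=
  (isRightFactor_symProd_iff (shift_ne_zero ξ hL) (shift_ne_zero ξ hP)).2
    (((isRightFactor_symProd_iff hL hP).1 h).shift ξ)

theorem IsQuasiSymmetricQuotient.shift {M L Q : DiffOp C} (hL : L ≠ 0)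
    (h : IsQuasiSymmetricQuotient M L Q) (ξ : C) :
    IsQuasiSymmetricQuotient (M.shift ξ) (L.shift ξ) (Q.shift ξ) := by
  refine ⟨h.1.shift ξ, h.2.1.shift_symProd hL h.1.ne_zero ξ, fun P hP hPM => ?_⟩
  have h1 := hPM.shift_symProd (shift_ne_zero ξ hL) hP (-ξ)
  rw [shift_neg_shift, shift_neg_shift] at h1
  have h2 := h.2.2 _ (shift_ne_zero (-ξ) hP) h1
  rwa [ord_shift] at h2 ⊢

/-- The translated pair has a colon operator of its own, and by uniqueness of quotients it is
`Q.shift ξ`. The operators `N` and `B` need not be followed. -/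
theorem IsColonOperator.shift [CharZero C] {M L Q : DiffOp C} {N B : ℕ → (RatFunc C)[X]}
    (h : IsColonOperator M L Q N B) (hM : M ≠ 0) (hL : 0 < L.ord) (ξ : C) :
    ∃ N' B', IsColonOperator (M.shift ξ) (L.shift ξ) (Q.shift ξ) N' B' := by
  have hL0 := ne_zero_of_ord_pos hL
  obtain ⟨Q', N', B', h'⟩ := exists_isColonOperator (shift_ne_zero ξ hM)
    (show 0 < (L.shift ξ).ord by rwa [ord_shift])
  have := h'.eq_of_isQuasiSymmetricQuotient (shift_ne_zero ξ hL0)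
    ((h.isQuasiSymmetricQuotient hL0).shift hL0 ξ)
  exact ⟨N', B', this ▸ h'⟩

end DiffOp

open DiffOp

/-! ### The global algorithm -/

section Global

/-- The invariant of the global algorithm. -/
def GlobalInvariant (M L Q : DiffOp C) : GlobalState C → Prop
  | .start => True
  | .call ξ s => IsOrdinaryPoint ξ L ∧ IsOrdinaryPoint ξ M ∧
      LocalInvariant (M.shift ξ) (L.shift ξ) (Q.shift ξ) s
  | .done out => out = some Q

variable [CharZero C] {M L Q : DiffOp C} {N B : ℕ → (RatFunc C)[X]}

theorem GlobalInvariant.step (h : IsColonOperator M L Q N B) (hL : 0 < L.ord) (hM : 0 < M.ord)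
    {s t : GlobalState C} (hs : GlobalInvariant M L Q s) (hst : GlobalStep M L s t) :
    GlobalInvariant M L Q t := by
  cases hst with
  | choose ξ hξL hξM => exact ⟨hξL, hξM, trivial⟩
  | inner ξ s t hst =>
    obtain ⟨hξL, hξM, hs⟩ := hs
    obtain ⟨N', B', h'⟩ := h.shift (ne_zero_of_ord_pos hM) hL ξ
    exact ⟨hξL, hξM, hs.step h' (by rwa [ord_shift]) (by rwa [ord_shift]) (isRegular_shift hξL)
      (isRegular_shift hξM) hst⟩
  | fail ξ =>
    obtain ⟨-, -, hs⟩ := hs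
    cases hs
  | success ξ P =>
    obtain ⟨-, -, hs⟩ := hs
    obtain rfl : P = Q.shift ξ := Option.some.inj hs
    exact congrArg some (shift_neg_shift ξ Q)

theorem GlobalInvariant.progress (h : IsColonOperator M L Q N B) (hL : 0 < L.ord)
    (hM : 0 < M.ord) {s : GlobalState C} (hs : GlobalInvariant M L Q s) :
    s = .done (some Q) ∨ ∃ t, GlobalStep M L s t := by
  cases s with
  | start =>
    obtain ⟨ξ, hξL, hξM⟩ := exists_isOrdinaryPoint L M
    exact Or.inr ⟨_, .choose ξ hξL hξM⟩
  | call ξ s =>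
    obtain ⟨hξL, hξM, hs⟩ := hs
    obtain ⟨N', B', h'⟩ := h.shift (ne_zero_of_ord_pos hM) hL ξ
    rcases hs.progress h' (by rwa [ord_shift]) (by rwa [ord_shift]) (isRegular_shift hξL)
      (isRegular_shift hξM) with rfl | ⟨t, ht⟩
    · exact Or.inr ⟨_, .success ξ _⟩
    · exact Or.inr ⟨_, .inner ξ s t ht⟩
  | done out => exact Or.inl (by rw [show out = some Q from hs])

theorem acc_globalStep_start (h : IsColonOperator M L Q N B) (hL : 0 < L.ord) (hM : 0 < M.ord) :
    Acc (fun t s => GlobalStep M L s t) .start := by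
  have hdone (out) : Acc (fun t s => GlobalStep M L s t) (.done out) :=
    ⟨_, fun t ht => by cases ht⟩
  refine ⟨_, fun t ht => ?_⟩
  cases ht with
  | choose ξ hξL hξM =>
    obtain ⟨N', B', h'⟩ := h.shift (ne_zero_of_ord_pos hM) hL ξ
    have hacc : Acc (fun t s => LocalStep (M.shift ξ) (L.shift ξ) s t) .start :=
      LocalInvariant.acc h' (by rwa [ord_shift]) (by rwa [ord_shift]) (isRegular_shift hξL)
        (isRegular_shift hξM) trivial
    -- The point `ξ` stays fixed during the call, so accessibility passes from each local state to
    -- the global state that wraps it.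
    generalize (LocalState.start : LocalState C) = s₀ at hacc
    induction hacc with
    | intro s _ ih =>
      refine ⟨_, fun t ht => ?_⟩
      cases ht with
      | inner _ _ t hst => exact ih t hst
      | fail => exact hdone _
      | success => exact hdone _

theorem algorithmReturns (h : IsColonOperator M L Q N B) (hL : 0 < L.ord) (hM : 0 < M.ord) :
    AlgorithmReturns M L (some Q) := by
  refine ⟨fun ⟨run, h0, hrun⟩ => ?_, fun s hs => ?_⟩
  · have hacc := acc_globalStep_start h hL hM
    rw [← h0] at hacc
    have key (s : GlobalState C) (hacc : Acc (fun t s => GlobalStep M L s t) s) :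
        ∀ n, run n ≠ s := by
      induction hacc with
      | intro s _ ih => exact fun n hn => ih (run (n + 1)) (hn ▸ hrun n) (n + 1) rfl
    exact key _ hacc 0 rfl
  · have hinv : GlobalInvariant M L Q s := by
      induction hs with
      | refl => trivial
      | tail _ hst ih => exact ih.step h hL hM hst
    exact hinv.progress h hL hM

end Global

end SymDiv

end

/-- The colon operator exists and has the order of the colon space at every ordinary point of `L`
and `M`, so that the conclusion does not depend on the solutions being algebraic. -/
theorem mainTheorem7 {C : Type*} [Field C] [IsAlgClosed C] [CharZero C]
    (L M : SymDiv.DiffOp C) (hL : 0 < L.ord) (hM : 0 < M.ord)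
    (hLalg : L.HasOnlyAlgebraicSolutions) (hMalg : M.HasOnlyAlgebraicSolutions) :
    ∃ Q : SymDiv.DiffOp C,
      SymDiv.DiffOp.IsQuasiSymmetricQuotient M L Q ∧
      (∀ Q' : SymDiv.DiffOp C, SymDiv.DiffOp.IsQuasiSymmetricQuotient M L Q' → Q' = Q) ∧
      SymDiv.AlgorithmReturns M L (some Q) := by
  obtain ⟨Q, N, B, h⟩ :=
    SymDiv.DiffOp.exists_isColonOperator (SymDiv.DiffOp.ne_zero_of_ord_pos hM) hL
  have hL0 := SymDiv.DiffOp.ne_zero_of_ord_pos hL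
  exact ⟨Q, h.isQuasiSymmetricQuotient hL0, fun _ => h.eq_of_isQuasiSymmetricQuotient hL0,
    SymDiv.algorithmReturns h hL hM⟩
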